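/- Let $k$ be a field. An $\mathbb{N}$-graded $k$-algebra $A=\bigoplus_{n\ge 0}A_n$ with $A_0=k$ is called quadratic if $A=T_k(V)/\langle R\rangle$, with the usual grading, for a finite-dimensional vector space $V$ and a subspace $R\subseteq V\otimes V$. A quadratic algebra $A$ is called Koszul if the trivial left module ${}_Ak=A/A_{\ge 1}$ has a resolution $\cdots\to P_1\to P_0\to {}_Ak\to 0$ by graded projective left $A$-modules and degree-preserving maps such that $P_n$ is generated in degree $n$ for all $n\ge 0$. Let $A$ be a subalgebra of a $k$-algebra $B$, let $y_1,y_2\in B$ and $p,q\in k$, and let $\sigma=(\sigma_{ij}):A\to M_{2\times 2}(A)$ be a map. We say that $B=A_P[y_1,y_2;\sigma]$, $P=\{p,q\}$, is a trimmed right double Ore extension of $A$ if $B$ is generated by $A$, $y_1$ and $y_2$; $y_2y_1=p\,y_1y_2+q\,y_1^2$; $B$ is a free left $A$-module with basis $\{y_1^iy_2^j : i,j\ge 0\}$; and $y_ia=\sigma_{i1}(a)y_1+\sigma_{i2}(a)y_2$ for all $a\in A$ and $i=1,2$. Proposition. Let $A$ be a Koszul algebra and let $B=A_P[y_1,y_2;\sigma]$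 be a trimmed right double Ore extension of $A$ such that every $\sigma_{ij}$ preserves degrees, i.e. $\sigma_{ij}(A_n)\subseteq A_n$ for all $n$. Then $B$ is a Koszul algebra for the grading that extends the grading of $A$ and in which $y_1$ and $y_2$ have degree $1$, i.e. $B_n=\sum_{m+i+j=n}A_m\,y_1^iy_2^j$. -/

import Mathlib

universe u

/-- The family `𝒜` of subspaces is an `ℕ`-grading of the `k`-algebra `A`. -/
def IsGradedAlgebra {k A : Type*} [Field k] [Ring A] [Algebra k A]
    (𝒜 : ℕ → Submodule k A) : Prop :=
  Nonempty (GradedAlgebra 𝒜)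

/-- The canonical algebra homomorphism `T_k(A₁) → A`. -/
noncomputable def tensorToAlgebra {k A : Type*} [Field k] [Ring A] [Algebra k A]
    (𝒜 : ℕ → Submodule k A) : TensorAlgebra k (𝒜 1) →ₐ[k] A :=
  TensorAlgebra.lift k (𝒜 1).subtype

/-- `A`, graded by `𝒜`, is a quadratic algebra: it is a connected graded algebra, and it is
`T_k(V) / ⟨R⟩` with its usual grading, where `V = A₁` is finite-dimensional and
`R` is a subspace of `V ⊗ V`. -/
structure IsQuadraticAlgebra {k A : Type*} [Field k] [Ring A] [Algebra k A]
    (𝒜 : ℕ → Submodule k A) : Prop where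
  graded : IsGradedAlgebra 𝒜
  nontrivial : Nontrivial A
  degree_zero : 𝒜 0 = LinearMap.range (Algebra.linearMap k A)
  finite_degree_one : FiniteDimensional k (𝒜 1)
  generated : Function.Surjective (tensorToAlgebra 𝒜)
  relations : ∃ R : Submodule k (TensorAlgebra k (𝒜 1)),
    R ≤ LinearMap.range (TensorAlgebra.ι k (M := 𝒜 1)) ^ 2 ∧
    ∀ t, tensorToAlgebra 𝒜 t = 0 ↔
      t ∈ TwoSidedIdeal.span (R : Set (TensorAlgebra k (𝒜 1)))

/-- The left ideal `A_{≥ 1}`. -/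
def augmentationIdeal {k A : Type*} [Field k] [Ring A] [Algebra k A]
    (𝒜 : ℕ → Submodule k A) : Submodule A A :=
  Submodule.span A {a | ∃ n, 1 ≤ n ∧ a ∈ 𝒜 n}

/-- The trivial left module `k = A / A_{≥ 1}`, which lives in degree `0`. -/
abbrev TrivialModule {k A : Type*} [Field k] [Ring A] [Algebra k A]
    (𝒜 : ℕ → Submodule k A) : Type _ :=
  A ⧸ augmentationIdeal 𝒜

/-- A resolution `⋯ → P₁ → P₀ → k → 0` of the trivial left `A`-module by graded projective left
modules and degree-preserving maps, in which `P n` is generated in degree `n`.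
Here `deg n m` is the component of degree `m` of `P n`. -/
structure LinearProjectiveResolution {k : Type*} {A : Type u} [Field k] [Ring A] [Algebra k A]
    (𝒜 : ℕ → Submodule k A) where
  P : ℕ → Type u
  [addCommGroup : ∀ n, AddCommGroup (P n)]
  [module : ∀ n, Module A (P n)]
  projective : ∀ n, Module.Projective A (P n)
  deg : ∀ n, ℕ → AddSubgroup (P n)
  isInternal : ∀ n, DirectSum.IsInternal (deg n)
  smul_mem : ∀ n i j (a : A) (x : P n), a ∈ 𝒜 i → x ∈ deg n j → a • x ∈ deg n (i + j)
  generated : ∀ n, Submodule.span A (deg n n : Set (P n)) = ⊤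
  d : ∀ n, P (n + 1) →ₗ[A] P n
  d_mem : ∀ n m x, x ∈ deg (n + 1) m → d n x ∈ deg n m
  ε : P 0 →ₗ[A] TrivialModule 𝒜
  ε_eq_zero : ∀ m x, 1 ≤ m → x ∈ deg 0 m → ε x = 0
  exact_d : ∀ n, Function.Exact (d (n + 1)) (d n)
  exact_ε : Function.Exact (d 0) ε
  surjective_ε : Function.Surjective ε

/-- `A`, graded by `𝒜`, is a Koszul algebra. -/
def IsKoszulAlgebra {k A : Type*} [Field k] [Ring A] [Algebra k A]
    (𝒜 : ℕ → Submodule k A) : Prop :=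
  IsQuadraticAlgebra 𝒜 ∧ Nonempty (LinearProjectiveResolution 𝒜)

/-- `B = A_P[y₁, y₂; σ, δ, τ]` is a right double Ore extension of its subalgebra `A`, where
`P = {p, q}` and `τ = {τ₀, τ₁, τ₂}`. -/
structure IsRightDoubleOreExtension {k B : Type*} [Field k] [Ring B] [Algebra k B]
    (A : Subalgebra k B) (p q : k) (y₁ y₂ : B) (σ : A → Matrix (Fin 2) (Fin 2) A)
    (δ : A → Fin 2 → A) (τ₀ τ₁ τ₂ : A) : Prop where
  generated : Algebra.adjoin k ((A : Set B) ∪ {y₁, y₂}) = ⊤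
  relation : y₂ * y₁ = p • (y₁ * y₂) + q • y₁ ^ 2 + τ₁ * y₁ + τ₂ * y₂ + τ₀
  linearIndependent : LinearIndependent A (fun ij : ℕ × ℕ => y₁ ^ ij.1 * y₂ ^ ij.2)
  span_eq_top : Submodule.span A (Set.range fun ij : ℕ × ℕ => y₁ ^ ij.1 * y₂ ^ ij.2) = ⊤
  y₁_mul : ∀ a : A, y₁ * a = σ a 0 0 * y₁ + σ a 0 1 * y₂ + δ a 0
  y₂_mul : ∀ a : A, y₂ * a = σ a 1 0 * y₁ + σ a 1 1 * y₂ + δ a 1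

/-- `B = A_P[y₁, y₂; σ]` is a trimmed right double Ore extension of `A`: `δ = 0` and `τ = {0}`. -/
def IsTrimmedRightDoubleOreExtension {k B : Type*} [Field k] [Ring B] [Algebra k B]
    (A : Subalgebra k B) (p q : k) (y₁ y₂ : B) (σ : A → Matrix (Fin 2) (Fin 2) A) : Prop :=
  IsRightDoubleOreExtension A p q y₁ y₂ σ 0 0 0 0

/-- The grading of `B = A_P[y₁, y₂; σ]` that extends the grading `𝒜` of `A` and in which `y₁` and
`y₂` have degree `1`: the component of degree `n` is the sum of all `A_m y₁^i y₂^j` with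
`m + i + j = n`. -/
def doubleOreGrading {k B : Type*} [Field k] [Ring B] [Algebra k B]
    (A : Subalgebra k B) (𝒜 : ℕ → Submodule k A) (y₁ y₂ : B) : ℕ → Submodule k B :=
  fun n => Submodule.span k
    {b | ∃ m i j, m + i + j = n ∧ ∃ a ∈ 𝒜 m, b = (a : B) * (y₁ ^ i * y₂ ^ j)}

/-!
Call a graded module linear in degree `n` if it has a cover by a free module on generators of
degree `n` whose kernel is linear in degree `n + 1`, coinductively. By graded Nakayama, a quadratic
algebra is Koszul exactly when its trivial module is linear in degree `0`. By the horseshoe lemma,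
linear modules are closed under extensions. Killing `y₁` and `y₂` is a retraction `B → A`, which
makes `A` a `B`-module with the linear resolution `0 → B(-2) → B(-1)² → B → A → 0`: the relation
`y₂ y₁ = p y₁ y₂ + q y₁²` generates the syzygies of `(y₁, y₂)`. So restriction along `B → A` turns
a linear resolution of `k` over `A` into one over `B`. Finally, `B` has the universal property of
the algebra generated by `A₁`, `y₁`, `y₂` subject to the relations of `A`, the relation between
`y₁` and `y₂`, and the relations `y_i a = σ_{i1}(a) y₁ + σ_{i2}(a) y₂` for `a ∈ A₁`, all of which
are quadratic.
-/

open DirectSum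

section InternalGradings

variable {M N S T : Type*} [AddCommGroup M] [AddCommGroup N] [SetLike S M] [AddSubmonoidClass S M]
  [SetLike T N] [AddSubmonoidClass T N]

/-- The projection of a graded group onto its component of degree `m`, as an endomorphism. -/
def gradedProj (ℳ : ℕ → S) [Decomposition ℳ] (m : ℕ) : M →+ M where
  toFun x := decompose ℳ x m
  map_zero' := by simp
  map_add' := by simp

theorem gradedProj_mem (ℳ : ℕ → S) [Decomposition ℳ] (m : ℕ) (x : M) : gradedProj ℳ m x ∈ ℳ m :=
  SetLike.coe_mem _

theorem gradedProj_of_mem (ℳ : ℕ → S) [Decomposition ℳ] {l : ℕ} (m : ℕ) {x : M} (hx : x ∈ ℳ l) :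
    gradedProj ℳ m x = if l = m then x else 0 := by
  split_ifs with h
  · exact decompose_of_mem_same ℳ (h ▸ hx)
  · exact decompose_of_mem_ne ℳ hx h

theorem eq_zero_of_gradedProj_eq_zero (ℳ : ℕ → S) [Decomposition ℳ] {x : M}
    (hx : ∀ m, gradedProj ℳ m x = 0) : x = 0 :=
  (decompose ℳ).injective (DFinsupp.ext fun m => Subtype.ext ((hx m).trans (by simp)))

theorem gradedProj_map {ℳ : ℕ → S} {𝒩 : ℕ → T} [Decomposition ℳ] [Decomposition 𝒩] {f : M →+ N}
    (hf : ∀ m, ∀ x ∈ ℳ m, f x ∈ 𝒩 m) (m : ℕ) (x : M) :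
    gradedProj 𝒩 m (f x) = f (gradedProj ℳ m x) := by
  induction x using Decomposition.inductionOn ℳ with
  | zero => simp
  | @homogeneous l x =>
    rw [gradedProj_of_mem 𝒩 m (hf l x x.2), gradedProj_of_mem ℳ m x.2, apply_ite f, map_zero]
  | add x y hx hy => simp [hx, hy]

theorem isInternal_of_projections (ℳ : ℕ → S) (proj : ℕ → M →+ M)
    (hproj : ∀ l m, ∀ x ∈ ℳ l, proj m x = if l = m then x else 0)
    (hspan : ∀ x, x ∈ AddSubmonoid.closure (⋃ m, (ℳ m : Set M))) : IsInternal ℳ := by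
  have proj_sum (x : ⨁ m, ℳ m) (m : ℕ) : proj m (DirectSum.coeAddMonoidHom ℳ x) = x m := by
    induction x using DirectSum.induction_on with
    | zero => simp
    | add x y hx hy => simp [hx, hy]
    | of l x =>
      rw [coeAddMonoidHom_of, hproj l m x x.2]
      rcases eq_or_ne l m with rfl | hlm
      · simp
      · simp [of_eq_of_ne _ _ _ hlm.symm, hlm]
  refine ⟨fun x y hxy => DFinsupp.ext fun m => Subtype.ext ?_, ?_⟩
  · rw [← proj_sum, ← proj_sum, hxy]
  · have : AddSubmonoid.closure (⋃ m, (ℳ m : Set M)) ≤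
        AddMonoidHom.mrange (DirectSum.coeAddMonoidHom ℳ) :=
      AddSubmonoid.closure_le.2 (Set.iUnion_subset fun m x hx => ⟨of _ m ⟨x, hx⟩, by simp⟩)
    exact fun x => this (hspan x)

theorem map_mem_closure_iUnion (ℳ : ℕ → S) {𝒩 : ℕ → Set N} [Decomposition ℳ] (f : M →+ N)
    (hf : ∀ m, ∀ x ∈ ℳ m, ∃ l, f x ∈ 𝒩 l) (x : M) :
    f x ∈ AddSubmonoid.closure (⋃ m, 𝒩 m) := by
  induction x using Decomposition.inductionOn ℳ with
  | zero => simp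
  | homogeneous x => exact AddSubmonoid.subset_closure (Set.mem_iUnion.2 (hf _ x x.2))
  | add x y hx hy => exact map_add f x y ▸ add_mem hx hy

theorem isInternal_of_addEquiv {ℳ : ℕ → S} {𝒩 : ℕ → T} (hℳ : IsInternal ℳ) (e : N ≃+ M)
    (he : ∀ m x, x ∈ 𝒩 m ↔ e x ∈ ℳ m) : IsInternal 𝒩 := by
  let := hℳ.chooseDecomposition
  refine isInternal_of_projections 𝒩
    (fun m => e.symm.toAddMonoidHom.comp ((gradedProj ℳ m).comp e.toAddMonoidHom)) ?_ ?_
  · intro l m x hx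
    simp [gradedProj_of_mem ℳ m ((he l x).1 hx), apply_ite e.symm]
  · intro x
    simpa using map_mem_closure_iUnion ℳ e.symm.toAddMonoidHom
      (fun m y hy => ⟨m, (he m _).2 (by simpa using hy)⟩) (e x)

/-- The components of the graded group `M(-n)`: degrees are raised by `n`. -/
def shiftDeg (ℳ : ℕ → AddSubgroup M) (n m : ℕ) : AddSubgroup M :=
  if n ≤ m then ℳ (m - n) else ⊥

theorem mem_shiftDeg_iff {ℳ : ℕ → AddSubgroup M} {n m : ℕ} {x : M} :
    x ∈ shiftDeg ℳ n m ↔ x = 0 ∨ ∃ l, l + n = m ∧ x ∈ ℳ l := by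
  unfold shiftDeg
  split_ifs with hnm
  · refine ⟨fun hx => .inr ⟨m - n, Nat.sub_add_cancel hnm, hx⟩, ?_⟩
    rintro (rfl | ⟨l, rfl, hx⟩)
    · exact zero_mem _
    · simpa using hx
  · refine ⟨.inl, ?_⟩
    rintro (rfl | ⟨l, rfl, -⟩)
    · exact zero_mem _
    · omega

theorem isInternal_shiftDeg {ℳ : ℕ → AddSubgroup M} (hℳ : IsInternal ℳ) (n : ℕ) :
    IsInternal (shiftDeg ℳ n) := by
  let := hℳ.chooseDecomposition
  refine isInternal_of_projections _ (fun m => if n ≤ m then gradedProj ℳ (m - n) else 0) ?_ ?_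
  · intro l m x hx
    obtain rfl | ⟨l, rfl, hxl⟩ := mem_shiftDeg_iff.1 hx
    · simp
    · by_cases hnm : n ≤ m
      · simp [hnm, gradedProj_of_mem ℳ _ hxl, show l = m - n ↔ l + n = m by omega]
      · simp [hnm, show l + n ≠ m by omega]
  · exact fun x => map_mem_closure_iUnion ℳ (.id M)
      (fun m x hx => ⟨m + n, mem_shiftDeg_iff.2 (.inr ⟨m, rfl, hx⟩)⟩) x

/-- The componentwise grading of the group of finitely supported functions. -/
def finsuppDeg {ι : Type*} (ℳ : ι → ℕ → AddSubgroup M) (m : ℕ) : AddSubgroup (ι →₀ M) where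
  carrier := {x | ∀ i, x i ∈ ℳ i m}
  zero_mem' _ := zero_mem _
  add_mem' hx hy i := add_mem (hx i) (hy i)
  neg_mem' hx i := neg_mem (hx i)

theorem single_mem_finsuppDeg {ι : Type*} {ℳ : ι → ℕ → AddSubgroup M} {m : ℕ} {i : ι} {x : M}
    (hx : x ∈ ℳ i m) : Finsupp.single i x ∈ finsuppDeg ℳ m := by
  classical
  intro j
  rw [Finsupp.single_apply]
  split_ifs with hij
  exacts [hij ▸ hx, zero_mem _]

theorem isInternal_finsuppDeg {ι : Type*} {ℳ : ι → ℕ → AddSubgroup M}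
    (hℳ : ∀ i, IsInternal (ℳ i)) : IsInternal (finsuppDeg ℳ) := by
  let (i : ι) := (hℳ i).chooseDecomposition
  refine isInternal_of_projections _ (fun m => Finsupp.liftAddHom fun i =>
    (Finsupp.singleAddHom i).comp (gradedProj (ℳ i) m)) ?_ ?_
  · intro l m x hx
    have hsum : (x.sum fun i y => Finsupp.single i (gradedProj (ℳ i) m y)) =
        x.sum fun i y => Finsupp.single i (if l = m then y else 0) :=
      Finsupp.sum_congr fun i _ => by rw [gradedProj_of_mem (ℳ i) m (hx i)]
    refine hsum.trans ?_
    split_ifs <;> simp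
  · intro x
    induction x using Finsupp.induction_linear with
    | zero => exact zero_mem _
    | add x y hx hy => exact add_mem hx hy
    | single i x =>
      exact map_mem_closure_iUnion (ℳ i) (Finsupp.singleAddHom i)
        (fun m x hx => ⟨m, single_mem_finsuppDeg hx⟩) x

end InternalGradings

section GradedModules

variable {k : Type*} {A : Type u} [CommRing k] [Ring A] [Algebra k A]

/-- An `ℕ`-graded left module over the graded algebra `(A, 𝒜)`. The grading is by additive
subgroups, as in `LinearProjectiveResolution`. -/
structure GradedMod (𝒜 : ℕ → Submodule k A) where
  carrier : Type u
  [addCommGroup : AddCommGroup carrier]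
  [module : Module A carrier]
  deg : ℕ → AddSubgroup carrier
  isInternal : IsInternal deg
  smul_mem : ∀ {i j : ℕ} {a : A} {x : carrier}, a ∈ 𝒜 i → x ∈ deg j → a • x ∈ deg (i + j)

namespace GradedMod

variable {𝒜 : ℕ → Submodule k A}

instance : CoeSort (GradedMod 𝒜) (Type u) := ⟨carrier⟩

instance (M : GradedMod 𝒜) : AddCommGroup M := M.addCommGroup

instance (M : GradedMod 𝒜) : Module A M := M.module

noncomputable instance (M : GradedMod 𝒜) : Decomposition M.deg :=
  M.isInternal.chooseDecomposition

/-- The `A`-linear map `f` between graded modules preserves degrees. -/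
def IsGraded {M N : GradedMod 𝒜} (f : M →ₗ[A] N) : Prop :=
  ∀ m, ∀ x ∈ M.deg m, f x ∈ N.deg m

section Maps

variable {M N L : GradedMod 𝒜} {f : M →ₗ[A] N} {g : N →ₗ[A] L} {m : ℕ}

theorem IsGraded.comp (hg : IsGraded g) (hf : IsGraded f) : IsGraded (g ∘ₗ f) :=
  fun m x hx => hg m _ (hf m x hx)

theorem IsGraded.gradedProj_apply (hf : IsGraded f) (m : ℕ) (x : M) :
    gradedProj N.deg m (f x) = f (gradedProj M.deg m x) :=
  gradedProj_map (f := f.toAddMonoidHom) hf m x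

theorem IsGraded.exists_mem_deg_apply_eq (hf : IsGraded f) {x : M} (hx : f x ∈ N.deg m) :
    ∃ x' ∈ M.deg m, f x' = f x :=
  ⟨gradedProj M.deg m x, gradedProj_mem _ _ _, by
    rw [← hf.gradedProj_apply, gradedProj_of_mem _ _ hx, if_pos rfl]⟩

theorem IsGraded.mem_deg_of_injective (hf : IsGraded f) (hinj : Function.Injective f) {x : M}
    (hx : f x ∈ N.deg m) : x ∈ M.deg m := by
  obtain ⟨x', hx', h⟩ := hf.exists_mem_deg_apply_eq hx
  exact hinj h ▸ hx'

theorem IsGraded.exists_factor_of_injective {f : M →ₗ[A] L} (hf : IsGraded f) (hg : IsGraded g)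
    (hinj : Function.Injective g) (hrange : ∀ x, f x ∈ LinearMap.range g) :
    ∃ f' : M →ₗ[A] N, IsGraded f' ∧ ∀ x, g (f' x) = f x := by
  let f' := (LinearEquiv.ofInjective g hinj).symm.toLinearMap ∘ₗ f.codRestrict _ hrange
  have hgf' (x : M) : g (f' x) = f x :=
    congrArg Subtype.val ((LinearEquiv.ofInjective g hinj).apply_symm_apply ⟨f x, hrange x⟩)
  exact ⟨f', fun m x hx => hg.mem_deg_of_injective hinj (hgf' x ▸ hf m x hx), hgf'⟩

theorem gradedProj_smul [GradedAlgebra 𝒜] {n : ℕ} {x : M} (hx : x ∈ M.deg n) (m : ℕ) (a : A) :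
    gradedProj M.deg (m + n) (a • x) = gradedProj 𝒜 m a • x := by
  induction a using Decomposition.inductionOn 𝒜 with
  | zero => simp
  | @homogeneous l a =>
    rw [gradedProj_of_mem _ _ (M.smul_mem a.2 hx), gradedProj_of_mem _ _ a.2]
    simp [ite_smul]
  | add a b ha hb => simp [add_smul, ha, hb]

theorem isGraded_of_span_eq_top [GradedAlgebra 𝒜] {s : Set M} {n : ℕ} (hs : s ⊆ M.deg n)
    (hspan : Submodule.span A s = ⊤) (hf : ∀ x ∈ s, f x ∈ N.deg n) : IsGraded f := by
  have hproj (x : M) : ∀ m, gradedProj N.deg m (f x) = f (gradedProj M.deg m x) := by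
    induction (hspan ▸ Submodule.mem_top : x ∈ Submodule.span A s)
      using Submodule.closure_induction with
    | zero => simp
    | add x y _ _ hx hy => simp [hx, hy]
    | smul_mem a x hx =>
      intro m
      induction a using Decomposition.inductionOn 𝒜 with
      | zero => simp
      | @homogeneous l a =>
        rw [map_smul, gradedProj_of_mem _ _ (N.smul_mem a.2 (hf x hx)),
          gradedProj_of_mem _ _ (M.smul_mem a.2 (hs hx)), apply_ite f, map_smul, map_zero]
      | add a b ha hb => simp only [add_smul, map_add, ha, hb]
  intro m x hx
  rw [← if_pos (c := m = m) (t := x) (e := 0) rfl, ← gradedProj_of_mem _ _ hx, ← hproj]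
  exact gradedProj_mem _ _ _

end Maps

section Constructions

/-- The kernel of a degree-preserving map as a graded module. -/
noncomputable abbrev ker {M N : GradedMod 𝒜} (f : M →ₗ[A] N) (hf : IsGraded f) : GradedMod 𝒜 where
  carrier := LinearMap.ker f
  deg m := (M.deg m).comap (LinearMap.ker f).subtype.toAddMonoidHom
  isInternal := by
    let proj (m : ℕ) : LinearMap.ker f →+ LinearMap.ker f :=
      ((gradedProj M.deg m).comp (LinearMap.ker f).subtype.toAddMonoidHom).codRestrict _
        fun x => by simp [← hf.gradedProj_apply]
    refine isInternal_of_projections _ proj ?_ ?_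
    · intro l m x hx
      refine Subtype.ext ((gradedProj_of_mem M.deg m hx).trans ?_)
      split_ifs <;> rfl
    · classical
      intro x
      have hx : x = ∑ m ∈ (decompose M.deg x.1).support, proj m x :=
        Subtype.ext ((sum_support_decompose M.deg x.1).symm.trans
          (AddSubmonoidClass.coe_finsetSum (proj · x) _).symm)
      rw [hx]
      exact sum_mem fun m _ => AddSubmonoid.subset_closure
        (Set.mem_iUnion.2 ⟨m, gradedProj_mem M.deg m x.1⟩)
  smul_mem ha hx := M.smul_mem ha hx

/-- The direct sum of two graded modules. -/
abbrev prod (M N : GradedMod 𝒜) : GradedMod 𝒜 where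
  carrier := M × N
  deg m := (M.deg m).prod (N.deg m)
  isInternal := by
    refine isInternal_of_projections _ (fun m => (gradedProj M.deg m).prodMap
      (gradedProj N.deg m)) ?_ ?_
    · rintro l m ⟨x, y⟩ ⟨hx, hy⟩
      have := gradedProj_of_mem M.deg m hx
      have := gradedProj_of_mem N.deg m hy
      split_ifs with hlm <;> simp_all
    · rintro ⟨x, y⟩
      rw [← Prod.fst_add_snd (x, y)]
      refine add_mem ?_ ?_
      · exact map_mem_closure_iUnion M.deg (AddMonoidHom.inl M N)
          (fun m x hx => ⟨m, show (x, 0) ∈ (M.deg m).prod (N.deg m) from ⟨hx, zero_mem _⟩⟩) x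
      · exact map_mem_closure_iUnion N.deg (AddMonoidHom.inr M N)
          (fun m y hy => ⟨m, show (0, y) ∈ (M.deg m).prod (N.deg m) from ⟨zero_mem _, hy⟩⟩) y
  smul_mem ha hx := ⟨M.smul_mem ha hx.1, N.smul_mem ha hx.2⟩

/-- The direct sum of copies of `M` indexed by `ι`. -/
noncomputable abbrev finsupp (ι : Type u) (M : GradedMod 𝒜) : GradedMod 𝒜 where
  carrier := ι →₀ M
  deg := finsuppDeg fun _ => M.deg
  isInternal := isInternal_finsuppDeg fun _ => M.isInternal
  smul_mem ha hx i := M.smul_mem ha (hx i)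

/-- The free module `A(-n)` of rank one with generator in degree `n`. -/
abbrev self (𝒜 : ℕ → Submodule k A) [GradedAlgebra 𝒜] (n : ℕ) : GradedMod 𝒜 where
  carrier := A
  deg := shiftDeg (fun m => (𝒜 m).toAddSubgroup) n
  isInternal := isInternal_shiftDeg (Decomposition.isInternal 𝒜) n
  smul_mem {i j a x} ha hx := by
    obtain rfl | ⟨l, rfl, hxl⟩ := mem_shiftDeg_iff.1 hx
    · simp
    · exact mem_shiftDeg_iff.2 (.inr ⟨i + l, add_assoc _ _ _, SetLike.mul_mem_graded ha hxl⟩)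

theorem one_mem_self_deg [GradedAlgebra 𝒜] (n : ℕ) : (1 : A) ∈ (self 𝒜 n).deg n :=
  mem_shiftDeg_iff.2 (.inr ⟨0, zero_add n, SetLike.one_mem_graded 𝒜⟩)

theorem isGraded_toSpanSingleton [GradedAlgebra 𝒜] {M : GradedMod 𝒜} {n : ℕ} {x : M}
    (hx : x ∈ M.deg n) : IsGraded (M := self 𝒜 n) (LinearMap.toSpanSingleton A M x) := by
  intro m a ha
  obtain rfl | ⟨l, rfl, hal⟩ := mem_shiftDeg_iff.1 ha
  · simp
  · exact M.smul_mem hal hx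

end Constructions

end GradedMod

end GradedModules

namespace GradedMod

variable {k : Type*} {A : Type u} [CommRing k] [Ring A] [Algebra k A] {𝒜 : ℕ → Submodule k A}

section ShortExact

/-- There is a short exact sequence `0 → M' → M → M'' → 0` of graded modules and
degree-preserving maps. -/
def ShortExact (M' M M'' : GradedMod 𝒜) : Prop :=
  ∃ (f : M' →ₗ[A] M) (g : M →ₗ[A] M''), IsGraded f ∧ IsGraded g ∧ Function.Injective f ∧
    Function.Exact f g ∧ Function.Surjective g

theorem shortExact_ker {M N : GradedMod 𝒜} {f : M →ₗ[A] N} (hf : IsGraded f)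
    (hsurj : Function.Surjective f) : ShortExact (ker f hf) M N :=
  ⟨(LinearMap.ker f).subtype, f, fun _ _ hx => hx, hf, Subtype.val_injective,
    LinearMap.exact_subtype_ker_map f, hsurj⟩

variable {K' K'' F M' M M'' X : GradedMod 𝒜}

theorem IsGraded.exists_mem_deg_of_surjective {f : M →ₗ[A] M''} (hf : IsGraded f)
    (hsurj : Function.Surjective f) {m : ℕ} {y : M''} (hy : y ∈ M''.deg m) :
    ∃ x ∈ M.deg m, f x = y := by
  obtain ⟨x, rfl⟩ := hsurj y
  exact hf.exists_mem_deg_apply_eq hy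

theorem ShortExact.of_bijective {N : GradedMod 𝒜} (h : ShortExact M' M M'') {e : M'' →ₗ[A] N}
    (he : IsGraded e) (hbij : Function.Bijective e) : ShortExact M' M N := by
  obtain ⟨f, g, hf, hg, hinj, hexact, hsurj⟩ := h
  exact ⟨f, e ∘ₗ g, hf, he.comp hg, hinj, hexact.comp_injective e hbij.1 (map_zero e),
    hbij.2.comp hsurj⟩

theorem ShortExact.prod_right (h : ShortExact M' M M'') (X : GradedMod 𝒜) :
    ShortExact M' (M.prod X) (M''.prod X) := by
  obtain ⟨f, g, hf, hg, hinj, hexact, hsurj⟩ := h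
  refine ⟨LinearMap.inl A M X ∘ₗ f, g.prodMap .id, fun m x hx => ⟨hf m x hx, zero_mem _⟩,
    fun m x hx => ⟨hg m _ hx.1, hx.2⟩, LinearMap.inl_injective.comp hinj, ?_,
    hsurj.prodMap Function.surjective_id⟩
  rintro ⟨x, y⟩
  simp [Prod.ext_iff, hexact x, eq_comm (a := y), exists_and_right]

theorem ShortExact.finsupp (h : ShortExact M' M M'') (ι : Type u) :
    ShortExact (M'.finsupp ι) (M.finsupp ι) (M''.finsupp ι) := by
  obtain ⟨f, g, hf, hg, hinj, hexact, hsurj⟩ := h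
  refine ⟨Finsupp.mapRange.linearMap f, Finsupp.mapRange.linearMap g,
    fun m x hx i => hf m _ (hx i), fun m x hx i => hg m _ (hx i),
    Finsupp.mapRange_injective f (map_zero f) hinj, ?_,
    Finsupp.mapRange_surjective g (map_zero g) hsurj⟩
  rw [LinearMap.exact_iff, Finsupp.ker_mapRange,
    Finsupp.range_mapRange_linearMap f (LinearMap.ker_eq_bot.2 hinj), hexact.linearMap_ker_eq]

theorem ShortExact.exists_trans (h₁ : ShortExact K' F X) (h₂ : ShortExact K'' X M) :
    ∃ K, ShortExact K F M ∧ ShortExact K' K K'' := by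
  obtain ⟨f₁, g₁, hf₁, hg₁, hinj₁, hexact₁, hsurj₁⟩ := h₁
  obtain ⟨f₂, g₂, hf₂, hg₂, hinj₂, hexact₂, hsurj₂⟩ := h₂
  have hg := hg₂.comp hg₁
  refine ⟨ker (g₂ ∘ₗ g₁) hg, shortExact_ker hg (hsurj₂.comp hsurj₁), ?_⟩
  obtain ⟨g', hg', hfg'⟩ := IsGraded.exists_factor_of_injective
    (M := ker (g₂ ∘ₗ g₁) hg) (f := g₁ ∘ₗ (LinearMap.ker (g₂ ∘ₗ g₁)).subtype)
    (fun m x hx => hg₁ m _ hx) hf₂ hinj₂ fun x => (hexact₂ _).1 x.2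
  refine ⟨f₁.codRestrict _ fun x => by simp [hexact₁.apply_apply_eq_zero], g', hf₁, hg',
    fun x y hxy => hinj₁ (congrArg Subtype.val hxy), fun x => ?_, fun z => ?_⟩
  · rw [← hinj₂.eq_iff, hfg', map_zero]
    refine (hexact₁ x.1).trans ⟨?_, ?_⟩
    · exact fun ⟨y, hy⟩ => ⟨y, Subtype.ext hy⟩
    · exact fun ⟨y, hy⟩ => ⟨y, congrArg Subtype.val hy⟩
  · obtain ⟨x, hx⟩ := hsurj₁ (f₂ z)
    refine ⟨⟨x, ?_⟩, hinj₂ ((hfg' _).trans hx)⟩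
    simp [hx, hexact₂.apply_apply_eq_zero]

end ShortExact

section IsFreeInDegree

/-- The graded module `M` is isomorphic to a direct sum of copies of `A(-n)`. -/
def IsFreeInDegree (n : ℕ) (M : GradedMod 𝒜) : Prop :=
  ∃ (ι : Type u) (b : Module.Basis ι A M), ∀ i, b i ∈ M.deg n

variable {n : ℕ} {F F' K'' M' M M'' : GradedMod 𝒜}

theorem isFreeInDegree_of_subsingleton (n : ℕ) (M : GradedMod 𝒜) [Subsingleton M] :
    IsFreeInDegree n M :=
  ⟨PEmpty, Module.Basis.empty M, fun i => i.elim⟩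

theorem isFreeInDegree_self [GradedAlgebra 𝒜] (n : ℕ) : IsFreeInDegree n (self 𝒜 n) :=
  ⟨PUnit, Module.Basis.singleton PUnit A, fun _ => by
    simpa using! one_mem_self_deg (𝒜 := 𝒜) n⟩

theorem IsFreeInDegree.prod (hF : IsFreeInDegree n F) (hF' : IsFreeInDegree n F') :
    IsFreeInDegree n (F.prod F') := by
  obtain ⟨ι, b, hb⟩ := hF
  obtain ⟨ι', b', hb'⟩ := hF'
  refine ⟨ι ⊕ ι', b.prod b', ?_⟩
  rintro (i | i)
  · exact ⟨by simpa using hb i, by simp⟩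
  · exact ⟨by simp, by simpa using hb' i⟩

theorem IsFreeInDegree.finsupp (hF : IsFreeInDegree n F) (ι : Type u) :
    IsFreeInDegree n (F.finsupp ι) := by
  obtain ⟨κ, b, hb⟩ := hF
  refine ⟨Σ _ : ι, κ, Finsupp.basis fun _ => b, ?_⟩
  rintro ⟨i, j⟩
  rw [Finsupp.coe_basis]
  exact single_mem_finsuppDeg (hb j)

theorem IsFreeInDegree.exists_lift [GradedAlgebra 𝒜] (hF : IsFreeInDegree n F)
    {g : M →ₗ[A] M''} (hg : IsGraded g) (hsurj : Function.Surjective g) {f : F →ₗ[A] M''}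
    (hf : IsGraded f) : ∃ f' : F →ₗ[A] M, IsGraded f' ∧ ∀ x, g (f' x) = f x := by
  obtain ⟨ι, b, hb⟩ := hF
  choose c hc hgc using fun i => hg.exists_mem_deg_of_surjective hsurj (hf n _ (hb i))
  have hf' : ∀ i, b.constr ℕ c (b i) = c i := b.constr_basis ℕ c
  refine ⟨b.constr ℕ c, isGraded_of_span_eq_top (Set.range_subset_iff.2 hb) b.span_eq
    (Set.forall_mem_range.2 fun i => hf' i ▸ hc i), fun x => ?_⟩
  exact LinearMap.congr_fun (b.ext fun i => by simp [hgc] : g ∘ₗ b.constr ℕ c = f) x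

/-- Since `F` is free, the pullback of `M → M'' ← F` is `M' × F`. -/
theorem ShortExact.prod_of_isFreeInDegree [GradedAlgebra 𝒜] (h : ShortExact M' M M'')
    (hF : IsFreeInDegree n F) (hM'' : ShortExact K'' F M'') : ShortExact K'' (M'.prod F) M := by
  obtain ⟨f, g, hf, hg, hinj, hexact, hsurj⟩ := h
  obtain ⟨f'', g'', hf'', hg'', hinj'', hexact'', hsurj''⟩ := hM''
  obtain ⟨s, hs, hgs⟩ := hF.exists_lift hg hsurj hg''
  obtain ⟨t, ht, hft⟩ := (hs.comp hf'').exists_factor_of_injective hf hinj fun x =>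
    (hexact _).1 (by simp [hgs, hexact''.apply_apply_eq_zero])
  refine ⟨(-t).prod f'', f.coprod s, fun m x hx => ⟨(M'.deg m).neg_mem (ht m x hx), hf'' m x hx⟩,
    fun m x hx => add_mem (hf m _ hx.1) (hs m _ hx.2),
    fun x y hxy => hinj'' (congrArg Prod.snd hxy), ?_, fun y => ?_⟩
  · rintro ⟨x, y⟩
    constructor
    · intro hxy
      have hy : g'' y = 0 := by
        rw [← hgs, ← map_zero g, ← hxy]
        simp [hexact.apply_apply_eq_zero]
      obtain ⟨z, rfl⟩ := (hexact'' y).1 hy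
      refine ⟨z, Prod.ext (hinj ?_) rfl⟩
      simpa [hft, neg_eq_iff_add_eq_zero, add_comm] using hxy
    · rintro ⟨z, hz⟩
      obtain ⟨rfl, rfl⟩ := Prod.ext_iff.1 hz
      simp [hft]
  · obtain ⟨z, hz⟩ := hsurj'' (g y)
    obtain ⟨x, hx⟩ := (hexact (y - s z)).1 (by simp [hgs, hz])
    exact ⟨(x, z), by simp [hx]⟩

end IsFreeInDegree

end GradedMod

namespace GradedMod

variable {k : Type*} {A : Type u} [CommRing k] [Ring A] [Algebra k A] {𝒜 : ℕ → Submodule k A}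

section Linear

/-- `M` is a quotient `F / K`, where `F` is a direct sum of copies of `A(-n)` and `K` belongs to
the class `𝒞 (n + 1)`: one step of a linear resolution. -/
def HasLinearCover (𝒞 : ℕ → GradedMod 𝒜 → Prop) (n : ℕ) (M : GradedMod 𝒜) : Prop :=
  ∃ F K, IsFreeInDegree n F ∧ 𝒞 (n + 1) K ∧ ShortExact K F M

/-- The closure of the class `𝒞` under extensions. -/
inductive ExtClosure (𝒞 : ℕ → GradedMod 𝒜 → Prop) : ℕ → GradedMod 𝒜 → Prop
  | of {n : ℕ} {M : GradedMod 𝒜} : 𝒞 n M → ExtClosure 𝒞 n M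
  | ext {n : ℕ} {M' M M'' : GradedMod 𝒜} : ExtClosure 𝒞 n M' → ExtClosure 𝒞 n M'' →
      ShortExact M' M M'' → ExtClosure 𝒞 n M

/-- `M` has a linear free resolution starting in degree `n`. Being an infinite sequence of linear
covers, such a resolution is encoded coinductively: `M` belongs to a class all of whose members have
linear covers with kernel in the class. -/
def IsLinear (n : ℕ) (M : GradedMod 𝒜) : Prop :=
  ∃ 𝒞 : ℕ → GradedMod 𝒜 → Prop, (∀ n M, 𝒞 n M → HasLinearCover 𝒞 n M) ∧ 𝒞 n M

variable {𝒞 𝒟 : ℕ → GradedMod 𝒜 → Prop} {n : ℕ} {F M N : GradedMod 𝒜}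

theorem HasLinearCover.mono (h𝒞 : ∀ n M, 𝒞 n M → 𝒟 n M) (hM : HasLinearCover 𝒞 n M) :
    HasLinearCover 𝒟 n M := by
  obtain ⟨F, K, hF, hK, hM⟩ := hM
  exact ⟨F, K, hF, h𝒞 _ _ hK, hM⟩

/-- The horseshoe lemma, for one step of a resolution. -/
theorem ShortExact.exists_horseshoe [GradedAlgebra 𝒜] {M' M'' F' F'' K' K'' : GradedMod 𝒜}
    (h : ShortExact M' M M'') (h' : ShortExact K' F' M') (h'' : ShortExact K'' F'' M'')
    (hF'' : IsFreeInDegree n F'') : ∃ K, ShortExact K (F'.prod F'') M ∧ ShortExact K' K K'' :=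
  (h'.prod_right F'').exists_trans (h.prod_of_isFreeInDegree hF'' h'')

theorem HasLinearCover.of_extClosure [GradedAlgebra 𝒜]
    (h𝒞 : ∀ n M, 𝒞 n M → HasLinearCover (ExtClosure 𝒞) n M) (hM : ExtClosure 𝒞 n M) :
    HasLinearCover (ExtClosure 𝒞) n M := by
  induction hM with
  | of hM => exact h𝒞 _ _ hM
  | ext _ _ h hM' hM'' =>
    obtain ⟨F', K', hF', hK', h'⟩ := hM'
    obtain ⟨F'', K'', hF'', hK'', h''⟩ := hM''
    obtain ⟨K, hK, hKK⟩ := h.exists_horseshoe h' h'' hF''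
    exact ⟨F'.prod F'', K, hF'.prod hF'', .ext hK' hK'' hKK, hK⟩

theorem isLinear_of_forall_hasLinearCover_extClosure [GradedAlgebra 𝒜]
    (h𝒞 : ∀ n M, 𝒞 n M → HasLinearCover (ExtClosure 𝒞) n M) (hM : 𝒞 n M) : IsLinear n M :=
  ⟨ExtClosure 𝒞, fun _ _ => .of_extClosure h𝒞, .of hM⟩

theorem isLinear_iff_hasLinearCover : IsLinear n M ↔ HasLinearCover IsLinear n M := by
  constructor
  · rintro ⟨𝒞, h𝒞, hM⟩
    exact (h𝒞 n M hM).mono fun _ _ hK => ⟨𝒞, h𝒞, hK⟩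
  · intro hM
    refine ⟨fun n M => HasLinearCover IsLinear n M, fun n M hM => hM.mono ?_, hM⟩
    rintro n M ⟨𝒞, h𝒞, hM⟩
    exact (h𝒞 n M hM).mono fun _ _ hK => ⟨𝒞, h𝒞, hK⟩

theorem IsLinear.of_bijective (hM : IsLinear n M) {e : M →ₗ[A] N} (he : IsGraded e)
    (hbij : Function.Bijective e) : IsLinear n N := by
  obtain ⟨F, K, hF, hK, h⟩ := isLinear_iff_hasLinearCover.1 hM
  exact isLinear_iff_hasLinearCover.2 ⟨F, K, hF, hK, h.of_bijective he hbij⟩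

theorem IsFreeInDegree.isLinear (hF : IsFreeInDegree n F) : IsLinear n F := by
  refine ⟨IsFreeInDegree, fun n F hF => ⟨F, _, hF, ?_, shortExact_ker (f := .id)
    (fun _ _ hx => hx) Function.surjective_id⟩, hF⟩
  have : Subsingleton (LinearMap.ker (.id : F →ₗ[A] F)) := by
    rw [LinearMap.ker_id]
    infer_instance
  exact isFreeInDegree_of_subsingleton _ _

theorem IsLinear.finsupp (hM : IsLinear n M) (ι : Type u) : IsLinear n (M.finsupp ι) := by
  refine ⟨fun n N => ∃ M, IsLinear n M ∧ N = M.finsupp ι, ?_, M, hM, rfl⟩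
  rintro n _ ⟨M, hM, rfl⟩
  obtain ⟨F, K, hF, hK, h⟩ := isLinear_iff_hasLinearCover.1 hM
  exact ⟨F.finsupp ι, K.finsupp ι, hF.finsupp ι, ⟨K, hK, rfl⟩, h.finsupp ι⟩

end Linear

end GradedMod

namespace GradedMod

section Projective

variable {k : Type*} {A : Type u} [Field k] [Ring A] [Algebra k A] {𝒜 : ℕ → Submodule k A}
  [GradedAlgebra 𝒜]

theorem gradedProj_mul_eq_zero {d : ℕ} {a b : A} (ha : gradedProj 𝒜 0 a = 0)
    (hb : ∀ q < d, gradedProj 𝒜 q b = 0) : gradedProj 𝒜 d (a * b) = 0 := by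
  have hmul : gradedProj 𝒜 d (a * b) =
      ∑ pq ∈ Finset.HasAntidiagonal.antidiagonal d, gradedProj 𝒜 pq.1 a * gradedProj 𝒜 pq.2 b := by
    simp only [gradedProj, AddMonoidHom.coe_mk, ZeroHom.coe_mk, decompose_mul,
      coe_mul_apply_eq_sum_antidiagonal]
  refine hmul.trans (Finset.sum_eq_zero fun pq hpq => ?_)
  obtain hq | hq := (Finset.HasAntidiagonal.antidiagonal.snd_le hpq).lt_or_eq
  · rw [hb _ hq, mul_zero]
  · have hp : pq.1 = 0 := by
      have := Finset.HasAntidiagonal.mem_antidiagonal.1 hpq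
      omega
    rw [hp, ha, zero_mul]

/-- A form of the graded Nakayama lemma. -/
theorem eq_zero_of_isIdempotentElem {ι : Type*} {e : (ι →₀ A) →ₗ[A] (ι →₀ A)}
    (he : IsIdempotentElem e) (h₀ : ∀ x i, gradedProj 𝒜 0 (e x i) = 0) : e = 0 := by
  have key (d : ℕ) : ∀ x i, gradedProj 𝒜 d (e x i) = 0 := by
    induction d using Nat.strong_induction_on with
    | _ d ih =>
      intro x i
      have hsum : e x i = (e x).sum fun j a => a * e (Finsupp.single j 1) i := by
        calc e x i = e (e x) i := by rw [← Module.End.mul_apply, he.eq]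
          _ = e ((e x).sum fun j a => a • Finsupp.single j 1) i := by simp
          _ = (e x).sum fun j a => a * e (Finsupp.single j 1) i := by
            simp only [Finsupp.sum, map_sum, map_smul, Finsupp.finsetSum_apply,
              Finsupp.smul_apply, smul_eq_mul]
      rw [hsum, Finsupp.sum, map_sum]
      exact Finset.sum_eq_zero fun j _ => gradedProj_mul_eq_zero (h₀ x j) fun q hq => ih q hq _ _
  exact LinearMap.ext fun x => Finsupp.ext fun i =>
    eq_zero_of_gradedProj_eq_zero 𝒜 fun d => key d x i

variable {ι : Type*} {M : GradedMod 𝒜} {n : ℕ}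

theorem gradedProj_zero_eq_zero_of_linearCombination_eq_zero
    (h𝒜 : 𝒜 0 = LinearMap.range (Algebra.linearMap k A)) [Module k M] [IsScalarTower k A M]
    {s : ι → M} (hs : ∀ i, s i ∈ M.deg n) (hli : LinearIndependent k s) {x : ι →₀ A}
    (hx : Finsupp.linearCombination A s x = 0) (i : ι) : gradedProj 𝒜 0 (x i) = 0 := by
  have hscalar (a : A) : ∃ c : k, algebraMap k A c = gradedProj 𝒜 0 a :=
    LinearMap.mem_range.1 (h𝒜 ▸ gradedProj_mem 𝒜 0 a)
  choose c hc using hscalar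
  have hsum : ∑ j ∈ x.support, c (x j) • s j = 0 := by
    have := congrArg (gradedProj M.deg (0 + n)) hx
    rw [Finsupp.linearCombination_apply, Finsupp.sum, map_sum, map_zero] at this
    simpa only [gradedProj_smul (hs _), ← hc, algebraMap_smul] using this
  by_cases hi : i ∈ x.support
  · rw [← hc, linearIndependent_iff'.1 hli _ _ hsum i hi, map_zero]
  · rw [Finsupp.notMem_support_iff.1 hi, map_zero]

theorem linearIndependent_of_projective (h𝒜 : 𝒜 0 = LinearMap.range (Algebra.linearMap k A))
    [Module k M] [IsScalarTower k A M] [Module.Projective A M] {s : ι → M}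
    (hs : ∀ i, s i ∈ M.deg n) (hli : LinearIndependent k s)
    (hspan : Submodule.span A (Set.range s) = ⊤) : LinearIndependent A s := by
  obtain ⟨t, ht⟩ := Module.projective_lifting_property (Finsupp.linearCombination A s) .id
    (LinearMap.range_eq_top.1 (by rw [Finsupp.range_linearCombination, hspan]))
  have hLt (y : M) : Finsupp.linearCombination A s (t y) = y := LinearMap.congr_fun ht y
  have he : (1 : Module.End A (ι →₀ A)) - t ∘ₗ Finsupp.linearCombination A s = 0 := by
    refine eq_zero_of_isIdempotentElem (𝒜 := 𝒜) ?_ fun x =>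
      gradedProj_zero_eq_zero_of_linearCombination_eq_zero h𝒜 hs hli (by simp [hLt])
    exact LinearMap.ext fun x => by simp [hLt]
  refine linearIndependent_iff.2 fun x hx => ?_
  simpa [hx] using LinearMap.congr_fun he x

theorem isFreeInDegree_of_projective (h𝒜 : 𝒜 0 = LinearMap.range (Algebra.linearMap k A))
    [Module.Projective A M] (hgen : Submodule.span A (M.deg n : Set M) = ⊤) :
    IsFreeInDegree n M := by
  let := Module.compHom M (algebraMap k A)
  have : IsScalarTower k A M := .of_algebraMap_smul fun _ _ => rfl
  let Mₙ : Submodule k M :=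
    { M.deg n with
      smul_mem' := fun c x hx => zero_add n ▸ M.smul_mem (h𝒜 ▸ ⟨c, rfl⟩) hx }
  let b := Module.Basis.ofVectorSpace k Mₙ
  let s (i : Module.Basis.ofVectorSpaceIndex k Mₙ) : M := b i
  have hspan : Submodule.span A (Set.range s) = ⊤ := by
    refine top_unique (hgen ▸ Submodule.span_le.2 fun x hx => ?_)
    have hx : x ∈ Submodule.span k (Set.range s) := by
      rw [show s = Mₙ.subtype ∘ b from rfl, Set.range_comp, Submodule.span_image, b.span_eq]
      exact ⟨⟨x, hx⟩, trivial, rfl⟩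
    exact Submodule.span_le_restrictScalars k A _ hx
  have hs (i) : s i ∈ M.deg n := (b i).2
  have hli : LinearIndependent k s := b.linearIndependent.map' Mₙ.subtype Mₙ.ker_subtype
  let bA := Module.Basis.mk (linearIndependent_of_projective h𝒜 hs hli hspan) hspan.ge
  exact ⟨_, bA, fun i => Module.Basis.mk_apply _ hspan.ge i ▸ hs i⟩

end Projective

end GradedMod

theorem mul_mem_augmentationIdeal {k A : Type*} [Field k] [Ring A] [Algebra k A]
    {𝒜 : ℕ → Submodule k A} [GradedAlgebra 𝒜] {n : ℕ} (hn : 1 ≤ n) {a : A} (ha : a ∈ 𝒜 n) (b : A) :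
    a * b ∈ augmentationIdeal 𝒜 := by
  induction b using Decomposition.inductionOn 𝒜 with
  | zero => simp
  | homogeneous b =>
    exact Submodule.subset_span ⟨_, hn.trans (Nat.le_add_right _ _), SetLike.mul_mem_graded ha b.2⟩
  | add b c hb hc => exact mul_add a b c ▸ add_mem hb hc

section Resolutions

variable {k : Type*} {A : Type u} [Field k] [Ring A] [Algebra k A] {𝒜 : ℕ → Submodule k A}

namespace GradedMod

section Trivial

/-- The trivial module `k`, concentrated in degree `0`. -/
noncomputable abbrev trivial (𝒜 : ℕ → Submodule k A) [GradedAlgebra 𝒜] : GradedMod 𝒜 where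
  carrier := TrivialModule 𝒜
  deg m := if m = 0 then ⊤ else ⊥
  isInternal := by
    refine isInternal_of_projections _ (fun m => if m = 0 then .id _ else 0) ?_ ?_
    · intro l m x hx
      split_ifs at hx ⊢ <;> simp_all
    · exact fun x => AddSubmonoid.subset_closure (Set.mem_iUnion.2 ⟨0, by simp⟩)
  smul_mem {i j a x} ha hx := by
    obtain ⟨b, rfl⟩ := Submodule.Quotient.mk_surjective _ x
    split_ifs at hx ⊢ with hij hj hj
    · trivial
    · trivial
    · exact (Submodule.Quotient.mk_eq_zero _).2 (mul_mem_augmentationIdeal (by omega) ha b)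
    · rw [AddSubgroup.mem_bot.1 hx, smul_zero]
      exact zero_mem _

variable [GradedAlgebra 𝒜]

theorem mem_trivial_deg_iff {m : ℕ} {x : TrivialModule 𝒜} :
    x ∈ (trivial 𝒜).deg m ↔ (1 ≤ m → x = 0) := by
  change x ∈ (if m = 0 then ⊤ else ⊥ : AddSubgroup _) ↔ _
  split_ifs with hm
  · simp [hm]
  · simp [Nat.one_le_iff_ne_zero, hm]

end Trivial

variable [GradedAlgebra 𝒜]

theorem IsLinear.nonempty_linearProjectiveResolution (h : IsLinear 0 (trivial 𝒜)) :
    Nonempty (LinearProjectiveResolution 𝒜) := by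
  choose F K hF hK hexact using fun n M (hM : IsLinear n M) =>
    isLinear_iff_hasLinearCover (𝒜 := 𝒜).1 hM
  let S (n : ℕ) : {M : GradedMod 𝒜 // IsLinear n M} :=
    n.rec ⟨trivial 𝒜, h⟩ fun n M => ⟨K n M M.2, hK n M M.2⟩
  let P (n : ℕ) : GradedMod 𝒜 := F n (S n).1 (S n).2
  have hP (n : ℕ) : IsFreeInDegree n (P n) := hF _ _ _
  choose ι π hι hπ hinj hexact hsurj using fun n =>
    (hexact n (S n).1 (S n).2 : ShortExact (S (n + 1)).1 (P n) (S n).1)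
  choose I b hb using hP
  exact ⟨{
    P n := P n
    projective n := .of_basis (b n)
    deg n := (P n).deg
    isInternal n := (P n).isInternal
    smul_mem n _ _ _ _ ha hx := (P n).smul_mem ha hx
    generated n := top_unique ((b n).span_eq.ge.trans
      (Submodule.span_mono (Set.range_subset_iff.2 (hb n))))
    d n := ι n ∘ₗ π (n + 1)
    d_mem n := (hι n).comp (hπ (n + 1))
    ε := π 0
    ε_eq_zero m x hm hx := mem_trivial_deg_iff.1 (hπ 0 m x hx) hm
    exact_d n := (hsurj (n + 2)).comp_exact_iff_exact.2
      ((hinj n).comp_exact_iff_exact.2 (hexact (n + 1)))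
    exact_ε := (hsurj 1).comp_exact_iff_exact.2 (hexact 0)
    surjective_ε := hsurj 0 }⟩

end GradedMod

namespace LinearProjectiveResolution

attribute [instance] addCommGroup module

/-- The `n`-th term of a linear projective resolution, bundled as a graded module. -/
abbrev term (R : LinearProjectiveResolution 𝒜) (n : ℕ) : GradedMod 𝒜 where
  carrier := R.P n
  addCommGroup := R.addCommGroup n
  module := R.module n
  deg := R.deg n
  isInternal := R.isInternal n
  smul_mem := R.smul_mem n _ _ _ _

open GradedMod

theorem isLinear_trivial [GradedAlgebra 𝒜] (R : LinearProjectiveResolution 𝒜)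
    (h𝒜 : 𝒜 0 = LinearMap.range (Algebra.linearMap k A)) : IsLinear 0 (trivial 𝒜) := by
  refine ⟨fun n M => ∃ π : R.term n →ₗ[A] M, IsGraded π ∧ Function.Surjective π ∧
    Function.Exact (R.d n) π, ?_, R.ε, ?_, R.surjective_ε, R.exact_ε⟩
  · rintro n M ⟨π, hπ, hsurj, hexact⟩
    have := R.projective n
    refine ⟨R.term n, ker π hπ, isFreeInDegree_of_projective h𝒜 (R.generated n), ?_,
      shortExact_ker hπ hsurj⟩
    refine ⟨(R.d n).codRestrict _ fun x => hexact.apply_apply_eq_zero x, R.d_mem n, ?_, ?_⟩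
    · rintro ⟨y, hy⟩
      obtain ⟨x, rfl⟩ := (hexact y).1 hy
      exact ⟨x, rfl⟩
    · exact fun x => Subtype.ext_iff.trans (R.exact_d n x)
  · exact fun m x hx => mem_trivial_deg_iff.2 fun hm => R.ε_eq_zero m x hm hx

end LinearProjectiveResolution

end Resolutions

namespace GradedMod

section Restrict

variable {k k' : Type*} {A B : Type u} [CommRing k] [Ring A] [Algebra k A] [CommRing k'] [Ring B]
  [Algebra k' B] {𝒜 : ℕ → Submodule k A} {ℬ : ℕ → Submodule k' B} {χ : B →+* A}

/-- The graded `B`-module obtained from the graded `A`-module `M` by restricting scalars along the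
degree-preserving homomorphism `χ : B → A`. -/
def restrict (hχ : ∀ n, ∀ b ∈ ℬ n, χ b ∈ 𝒜 n) (M : GradedMod 𝒜) : GradedMod ℬ where
  carrier := M
  module := Module.compHom M χ
  deg := M.deg
  isInternal := M.isInternal
  smul_mem hb hx := M.smul_mem (hχ _ _ hb) hx

variable {hχ : ∀ n, ∀ b ∈ ℬ n, χ b ∈ 𝒜 n} {n : ℕ} {F M N M' M'' : GradedMod 𝒜}

/-- An `A`-linear map, considered as a `B`-linear map. -/
def restrictMap (hχ : ∀ n, ∀ b ∈ ℬ n, χ b ∈ 𝒜 n) (f : M →ₗ[A] N) :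
    restrict hχ M →ₗ[B] restrict hχ N where
  toFun := f
  map_add' := f.map_add
  map_smul' b := f.map_smul (χ b)

theorem ShortExact.restrict (h : ShortExact M' M M'') :
    ShortExact (restrict hχ M') (restrict hχ M) (restrict hχ M'') := by
  obtain ⟨f, g, hf, hg, hinj, hexact, hsurj⟩ := h
  exact ⟨restrictMap hχ f, restrictMap hχ g, hf, hg, hinj, hexact, hsurj⟩

variable [GradedAlgebra 𝒜]

theorem IsFreeInDegree.exists_bijective (hF : IsFreeInDegree n F) :
    ∃ (ι : Type u) (e : (self 𝒜 n).finsupp ι →ₗ[A] F), IsGraded e ∧ Function.Bijective e := by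
  obtain ⟨ι, b, hb⟩ := hF
  refine ⟨ι, b.repr.symm.toLinearMap, ?_, b.repr.symm.bijective⟩
  refine isGraded_of_span_eq_top (n := n) (s := Set.range fun i => Finsupp.single i (1 : A))
    ?_ ?_ ?_
  · exact Set.range_subset_iff.2 fun i => single_mem_finsuppDeg (one_mem_self_deg n)
  · simpa using (Finsupp.basisSingleOne (R := A) (ι := ι)).span_eq
  · exact Set.forall_mem_range.2 fun i => by simpa using hb i

theorem IsFreeInDegree.isLinear_restrict (hself : ∀ n, IsLinear n (restrict hχ (self 𝒜 n)))
    (hF : IsFreeInDegree n F) : IsLinear n (restrict hχ F) := by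
  obtain ⟨ι, e, he, hbij⟩ := hF.exists_bijective
  have h : IsLinear n (restrict hχ ((self 𝒜 n).finsupp ι)) := (hself n).finsupp ι
  exact h.of_bijective (e := restrictMap hχ e) he hbij

theorem IsLinear.restrict [GradedAlgebra ℬ] (hself : ∀ n, IsLinear n (restrict hχ (self 𝒜 n)))
    (hM : IsLinear n M) : IsLinear n (restrict hχ M) := by
  let 𝒞 (n : ℕ) (N : GradedMod ℬ) : Prop :=
    IsLinear n N ∨ ∃ M, IsLinear n M ∧ N = GradedMod.restrict hχ M
  refine isLinear_of_forall_hasLinearCover_extClosure (𝒞 := 𝒞) ?_ (.inr ⟨M, hM, rfl⟩)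
  rintro n N (hN | ⟨M, hM, rfl⟩)
  · exact (isLinear_iff_hasLinearCover.1 hN).mono fun _ _ hK => .of (.inl hK)
  · obtain ⟨F, K, hF, hK, h⟩ := isLinear_iff_hasLinearCover.1 hM
    obtain ⟨G, L, hG, hL, hLGF⟩ :=
      isLinear_iff_hasLinearCover.1 (hF.isLinear_restrict hself)
    obtain ⟨X, hX, hLX⟩ := hLGF.exists_trans h.restrict
    exact ⟨G, X, hG, .ext (.of (.inl hL)) (.of (.inr ⟨K, hK, rfl⟩)) hLX, hX⟩

end Restrict

end GradedMod

section LocallyNilpotent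

theorem bijective_one_sub_of_locally_nilpotent {R M : Type*} [Ring R] [AddCommGroup M] [Module R M]
    {T : Module.End R M} (hT : ∀ x, ∃ n, (T ^ n) x = 0) : Function.Bijective ⇑(1 - T) := by
  constructor
  · rw [← LinearMap.ker_eq_bot, LinearMap.ker_eq_bot']
    intro x hx
    obtain ⟨n, hn⟩ := hT x
    have hfix : T x = x := (sub_eq_zero.1 hx).symm
    rw [← hn, Module.End.pow_apply, Function.iterate_fixed hfix]
  · intro x
    obtain ⟨n, hn⟩ := hT x
    refine ⟨(∑ i ∈ Finset.range n, T ^ i) x, ?_⟩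
    rw [← Module.End.mul_apply, mul_neg_geom_sum, LinearMap.sub_apply, hn, Module.End.one_apply,
      sub_zero]

end LocallyNilpotent

section QuantumPlane

variable {k R : Type*} [CommRing k] [Ring R] [Algebra k R] {p q : k} {x y : R}

theorem mul_pow_eq_of_mul_eq (h : y * x = p • (x * y) + q • x ^ 2) (i : ℕ) :
    y * x ^ i = p ^ i • (x ^ i * y) + (q * ∑ l ∈ Finset.range i, p ^ l) • x ^ (i + 1) := by
  induction i with
  | zero => simp
  | succ i ih =>
    calc y * x ^ (i + 1)
        = p ^ i • (x ^ i * (y * x)) + (q * ∑ l ∈ Finset.range i, p ^ l) • x ^ (i + 1 + 1) := by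
          rw [pow_succ x i, ← mul_assoc, ih, add_mul, smul_mul_assoc, smul_mul_assoc, mul_assoc,
            ← pow_succ]
      _ = p ^ (i + 1) • (x ^ (i + 1) * y) +
            (q * ∑ l ∈ Finset.range (i + 1), p ^ l) • x ^ (i + 1 + 1) := by
          rw [h, mul_add, mul_smul_comm, mul_smul_comm, ← mul_assoc, ← pow_succ, ← pow_add,
            smul_add, smul_smul, smul_smul, Finset.sum_range_succ, mul_add, add_smul, ← pow_succ,
            mul_comm q (p ^ i), add_assoc, add_comm ((q * _) • _)]

theorem mul_pow_mul_pow_eq_of_mul_eq (h : y * x = p • (x * y) + q • x ^ 2) (i j : ℕ) :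
    y * (x ^ i * y ^ j) = p ^ i • (x ^ i * y ^ (j + 1)) +
      (q * ∑ l ∈ Finset.range i, p ^ l) • (x ^ (i + 1) * y ^ j) := by
  rw [← mul_assoc, mul_pow_eq_of_mul_eq h, add_mul, smul_mul_assoc, smul_mul_assoc, mul_assoc,
    ← pow_succ']

end QuantumPlane

namespace IsTrimmedRightDoubleOreExtension

variable {k B : Type*} [Field k] [Ring B] [Algebra k B] {A : Subalgebra k B} {p q : k} {y₁ y₂ : B}
  {σ : A → Matrix (Fin 2) (Fin 2) A}

theorem y₂_mul_y₁ (h : IsTrimmedRightDoubleOreExtension A p q y₁ y₂ σ) :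
    y₂ * y₁ = p • (y₁ * y₂) + q • y₁ ^ 2 := by
  simpa using h.relation

theorem y₁_mul_smul (h : IsTrimmedRightDoubleOreExtension A p q y₁ y₂ σ) (a : A) (b : B) :
    y₁ * a • b = σ a 0 0 • (y₁ * b) + σ a 0 1 • (y₂ * b) := by
  simpa [Subalgebra.smul_def, add_mul, mul_assoc] using congrArg (· * b) (h.y₁_mul a)

theorem y₂_mul_smul (h : IsTrimmedRightDoubleOreExtension A p q y₁ y₂ σ) (a : A) (b : B) :
    y₂ * a • b = σ a 1 0 • (y₁ * b) + σ a 1 1 • (y₂ * b) := by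
  simpa [Subalgebra.smul_def, add_mul, mul_assoc] using congrArg (· * b) (h.y₂_mul a)

/-- The basis `y₁ ^ i * y₂ ^ j` of `B` over `A`. -/
noncomputable def basis (h : IsTrimmedRightDoubleOreExtension A p q y₁ y₂ σ) :
    Module.Basis (ℕ × ℕ) A B :=
  .mk h.linearIndependent h.span_eq_top.ge

theorem basis_apply (h : IsTrimmedRightDoubleOreExtension A p q y₁ y₂ σ) (i j : ℕ) :
    h.basis (i, j) = y₁ ^ i * y₂ ^ j :=
  Module.Basis.mk_apply _ _ _

theorem mem_of_monomial_mem (h : IsTrimmedRightDoubleOreExtension A p q y₁ y₂ σ)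
    {S : Submodule A B} (hS : ∀ i j, y₁ ^ i * y₂ ^ j ∈ S) (b : B) : b ∈ S := by
  have hle := h.span_eq_top.symm.trans_le (Submodule.span_le.2 (Set.range_subset_iff.2
    fun ij => hS ij.1 ij.2))
  exact hle trivial

theorem y₁_mul_mem_and_y₂_mul_mem (h : IsTrimmedRightDoubleOreExtension A p q y₁ y₂ σ)
    {S : Submodule A B} (hS₁ : ∀ i j, y₁ * (y₁ ^ i * y₂ ^ j) ∈ S)
    (hS₂ : ∀ i j, y₂ * (y₁ ^ i * y₂ ^ j) ∈ S) (b : B) : y₁ * b ∈ S ∧ y₂ * b ∈ S := by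
  let T : Submodule A B :=
    { carrier := {b | y₁ * b ∈ S ∧ y₂ * b ∈ S}
      zero_mem' := by simp
      add_mem' := fun {b c} hb hc =>
        ⟨mul_add y₁ b c ▸ add_mem hb.1 hc.1, mul_add y₂ b c ▸ add_mem hb.2 hc.2⟩
      smul_mem' := fun a b hb =>
        ⟨h.y₁_mul_smul a b ▸ add_mem (S.smul_mem _ hb.1) (S.smul_mem _ hb.2),
          h.y₂_mul_smul a b ▸ add_mem (S.smul_mem _ hb.1) (S.smul_mem _ hb.2)⟩ }
  exact h.mem_of_monomial_mem (S := T) (fun i j => ⟨hS₁ i j, hS₂ i j⟩) b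

section Division

/-- The `A`-linear map `B → B` dividing the monomials `y₁ ^ i * y₂ ^ (j + 1)` by `y₂` on the right
and killing the monomials `y₁ ^ i`. -/
noncomputable def divY₂ (h : IsTrimmedRightDoubleOreExtension A p q y₁ y₂ σ) : B →ₗ[A] B :=
  h.basis.constr ℕ fun
    | (_, 0) => 0
    | (i, j + 1) => y₁ ^ i * y₂ ^ j

theorem divY₂_y₁_pow (h : IsTrimmedRightDoubleOreExtension A p q y₁ y₂ σ) (i : ℕ) :
    h.divY₂ (y₁ ^ i) = 0 := by
  have hi : h.divY₂ (h.basis (i, 0)) = 0 := h.basis.constr_basis ℕ _ (i, 0)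
  simpa [h.basis_apply] using hi

theorem divY₂_mul_y₂ (h : IsTrimmedRightDoubleOreExtension A p q y₁ y₂ σ) (b : B) :
    h.divY₂ (b * y₂) = b := by
  have hcomp : h.divY₂ ∘ₗ LinearMap.mulRight A y₂ = .id := by
    refine h.basis.ext fun (i, j) => ?_
    have hij : h.divY₂ (h.basis (i, j + 1)) = y₁ ^ i * y₂ ^ j := h.basis.constr_basis ℕ _ _
    simpa [h.basis_apply, pow_succ, mul_assoc] using hij
  exact LinearMap.congr_fun hcomp b

/-- The `A`-linear map `B → B` dividing the monomials `y₁ ^ (i + 1)` by `y₁` and killing the other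
ones. -/
noncomputable def divY₁ (h : IsTrimmedRightDoubleOreExtension A p q y₁ y₂ σ) : B →ₗ[A] B :=
  h.basis.constr ℕ fun
    | (i + 1, 0) => y₁ ^ i
    | _ => 0

theorem divY₁_y₁_pow_succ (h : IsTrimmedRightDoubleOreExtension A p q y₁ y₂ σ) (i : ℕ) :
    h.divY₁ (y₁ ^ (i + 1)) = y₁ ^ i := by
  have hi : h.divY₁ (h.basis (i + 1, 0)) = y₁ ^ i := h.basis.constr_basis ℕ _ _
  simpa [h.basis_apply] using hi

/-- The `A`-span of the monomials whose degree in `y₂` is less than `n`. -/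
def degLT (A : Subalgebra k B) (y₁ y₂ : B) (n : ℕ) : Submodule A B :=
  Submodule.span A {b | ∃ i, ∃ j < n, b = y₁ ^ i * y₂ ^ j}

theorem monomial_mem_degLT (A : Subalgebra k B) (y₁ y₂ : B) (i : ℕ) {j n : ℕ} (hj : j < n) :
    y₁ ^ i * y₂ ^ j ∈ degLT A y₁ y₂ n :=
  Submodule.subset_span ⟨i, j, hj, rfl⟩

theorem degLT_zero : degLT A y₁ y₂ 0 = ⊥ := by
  simp [degLT]

theorem degLT_mono {m n : ℕ} (hmn : m ≤ n) : degLT A y₁ y₂ m ≤ degLT A y₁ y₂ n :=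
  Submodule.span_mono fun _ ⟨i, j, hj, hb⟩ => ⟨i, j, hj.trans_le hmn, hb⟩

theorem exists_mem_degLT (h : IsTrimmedRightDoubleOreExtension A p q y₁ y₂ σ) (b : B) :
    ∃ n, b ∈ degLT A y₁ y₂ n := by
  rw [← Submodule.mem_iSup_of_directed _ (Monotone.directed_le fun _ _ => degLT_mono)]
  exact h.mem_of_monomial_mem (fun i j =>
    Submodule.mem_iSup_of_mem (j + 1) (monomial_mem_degLT A y₁ y₂ i j.lt_succ_self)) b

theorem mul_y₂_mem_degLT {n : ℕ} {b : B} (hb : b ∈ degLT A y₁ y₂ n) :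
    b * y₂ ∈ degLT A y₁ y₂ (n + 1) := by
  have hle : degLT A y₁ y₂ n ≤ (degLT A y₁ y₂ (n + 1)).comap (LinearMap.mulRight A y₂) := by
    refine Submodule.span_le.2 ?_
    rintro _ ⟨i, j, hj, rfl⟩
    simpa [pow_succ, mul_assoc] using monomial_mem_degLT A y₁ y₂ i (Nat.succ_lt_succ hj)
  exact hle hb

theorem mul_y₁_mem_degLT (h : y₂ * y₁ = p • (y₁ * y₂) + q • y₁ ^ 2) (n : ℕ) :
    ∀ b ∈ degLT A y₁ y₂ n, b * y₁ ∈ degLT A y₁ y₂ n := by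
  induction n with
  | zero => simp [degLT_zero]
  | succ n ih =>
    suffices hle : degLT A y₁ y₂ (n + 1) ≤ (degLT A y₁ y₂ (n + 1)).comap (LinearMap.mulRight A y₁)
      from fun b hb => hle hb
    refine Submodule.span_le.2 ?_
    rintro _ ⟨i, _ | j, hj, rfl⟩
    · simpa [pow_succ] using monomial_mem_degLT A y₁ y₂ (i + 1) n.succ_pos
    · have hmul : y₁ ^ i * y₂ ^ j * y₁ ∈ degLT A y₁ y₂ n :=
        ih _ (monomial_mem_degLT A y₁ y₂ i (Nat.succ_lt_succ_iff.1 hj))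
      have heq : y₁ ^ i * y₂ ^ (j + 1) * y₁ =
          p • (y₁ ^ i * y₂ ^ j * y₁ * y₂) + q • (y₁ ^ i * y₂ ^ j * y₁ * y₁) := by
        rw [pow_succ, ← mul_assoc, mul_assoc _ y₂, h]
        simp only [mul_add, mul_smul_comm, pow_two, mul_assoc]
      change y₁ ^ i * y₂ ^ (j + 1) * y₁ ∈ degLT A y₁ y₂ (n + 1)
      rw [heq]
      exact add_mem ((degLT A y₁ y₂ _).smul_of_tower_mem p (mul_y₂_mem_degLT hmul))
        ((degLT A y₁ y₂ _).smul_of_tower_mem q (degLT_mono n.le_succ (ih _ hmul)))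

theorem divY₂_mem_degLT (h : IsTrimmedRightDoubleOreExtension A p q y₁ y₂ σ) {n : ℕ} {b : B}
    (hb : b ∈ degLT A y₁ y₂ (n + 1)) : h.divY₂ b ∈ degLT A y₁ y₂ n := by
  have hle : degLT A y₁ y₂ (n + 1) ≤ (degLT A y₁ y₂ n).comap h.divY₂ := by
    refine Submodule.span_le.2 ?_
    rintro _ ⟨i, _ | j, hj, rfl⟩
    · simp [divY₂_y₁_pow]
    · simpa [pow_succ, ← mul_assoc, divY₂_mul_y₂] using
        monomial_mem_degLT A y₁ y₂ i (Nat.succ_lt_succ_iff.1 hj)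
  exact hle hb

theorem sub_divY₂_mul_mem_degLT_one (h : IsTrimmedRightDoubleOreExtension A p q y₁ y₂ σ) (b : B) :
    b - h.divY₂ b * y₂ ∈ degLT A y₁ y₂ 1 := by
  refine h.mem_of_monomial_mem
    (S := (degLT A y₁ y₂ 1).comap (.id - LinearMap.mulRight A y₂ ∘ₗ h.divY₂)) ?_ b
  rintro i (_ | j)
  · simpa [divY₂_y₁_pow] using monomial_mem_degLT A y₁ y₂ i Nat.one_pos
  · simp [pow_succ, ← mul_assoc, divY₂_mul_y₂]

theorem divY₁_mul_y₁ (h : IsTrimmedRightDoubleOreExtension A p q y₁ y₂ σ) {b : B}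
    (hb : b ∈ degLT A y₁ y₂ 1) : h.divY₁ (b * y₁) = b := by
  have hle : degLT A y₁ y₂ 1 ≤ LinearMap.eqLocus (h.divY₁ ∘ₗ LinearMap.mulRight A y₁) .id := by
    refine Submodule.span_le.2 ?_
    rintro _ ⟨i, j, hj, rfl⟩
    obtain rfl := Nat.lt_one_iff.1 hj
    simpa [pow_succ] using h.divY₁_y₁_pow_succ i
  exact hle hb

theorem bijective_divY₂_comp_mulRight (h : IsTrimmedRightDoubleOreExtension A p q y₁ y₂ σ) :
    Function.Bijective (h.divY₂ ∘ₗ LinearMap.mulRight A (y₂ - q • y₁)) := by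
  let T : Module.End A B := h.divY₂ ∘ₗ LinearMap.mulRight A (q • y₁)
  have hT : h.divY₂ ∘ₗ LinearMap.mulRight A (y₂ - q • y₁) = 1 - T :=
    LinearMap.ext fun b => by simp [T, mul_sub, divY₂_mul_y₂]
  have hpow (n : ℕ) : ∀ b ∈ degLT A y₁ y₂ n, (T ^ n) b = 0 := by
    induction n with
    | zero => simp [degLT_zero]
    | succ n ih =>
      intro b hb
      refine ih _ (h.divY₂_mem_degLT ?_)
      simpa using (degLT A y₁ y₂ _).smul_of_tower_mem q (mul_y₁_mem_degLT h.y₂_mul_y₁ _ _ hb)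
  rw [hT]
  refine bijective_one_sub_of_locally_nilpotent fun b => ?_
  obtain ⟨n, hb⟩ := h.exists_mem_degLT b
  exact ⟨n, hpow n b hb⟩

theorem exists_of_mul_add_mul_eq_zero (h : IsTrimmedRightDoubleOreExtension A p q y₁ y₂ σ)
    {u v : B} (huv : u * y₁ + v * y₂ = 0) : ∃ r, r * (y₂ - q • y₁) = u ∧ r * -(p • y₁) = v := by
  obtain ⟨r, hr⟩ := h.bijective_divY₂_comp_mulRight.2 (h.divY₂ u)
  let u' := u - r * (y₂ - q • y₁)
  let v' := v + r * (p • y₁)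
  have huv' : u' * y₁ + v' * y₂ = 0 := by
    have hrel : (y₂ - q • y₁) * y₁ = p • y₁ * y₂ := by
      rw [sub_mul, h.y₂_mul_y₁, smul_mul_assoc, smul_mul_assoc, pow_two, add_sub_cancel_right]
    rw [← huv, sub_mul, add_mul, mul_assoc r, hrel, ← mul_assoc]
    abel
  have hu' : u' ∈ degLT A y₁ y₂ 1 := by
    have hdiv : h.divY₂ u' = 0 := by simpa [u', sub_eq_zero] using hr.symm
    simpa [hdiv] using h.sub_divY₂_mul_mem_degLT_one u'
  have hv' : v' = 0 := by
    have hdiv : h.divY₂ (u' * y₁) = 0 := by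
      simpa [degLT_zero] using h.divY₂_mem_degLT (mul_y₁_mem_degLT h.y₂_mul_y₁ _ _ hu')
    simpa [hdiv, divY₂_mul_y₂] using congrArg h.divY₂ huv'
  have hu'₀ : u' = 0 := by
    rw [← h.divY₁_mul_y₁ hu']
    simpa [hv'] using congrArg h.divY₁ huv'
  exact ⟨r, (sub_eq_zero.1 hu'₀).symm, by rw [mul_neg, ← eq_neg_of_add_eq_zero_left hv']⟩

/-- The map `B → B²`, `r ↦ (r (y₂ - q y₁), -r p y₁)`. Its value at `1` is the syzygy of `(y₁, y₂)`
given by the relation `y₂ y₁ = p y₁ y₂ + q y₁²`. -/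
def syzygyMap (p q : k) (y₁ y₂ : B) : B →ₗ[B] B × B :=
  LinearMap.toSpanSingleton B (B × B) (y₂ - q • y₁, -(p • y₁))

/-- The map `B² → B`, `(u, v) ↦ u y₁ + v y₂`. -/
def combinationMap (y₁ y₂ : B) : B × B →ₗ[B] B :=
  (LinearMap.toSpanSingleton B B y₁).coprod (LinearMap.toSpanSingleton B B y₂)

theorem syzygyMap_apply (p q : k) (y₁ y₂ r : B) :
    syzygyMap p q y₁ y₂ r = (r * (y₂ - q • y₁), r * -(p • y₁)) :=
  rfl

theorem combinationMap_apply (y₁ y₂ u v : B) :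
    combinationMap y₁ y₂ (u, v) = u * y₁ + v * y₂ :=
  rfl

theorem injective_syzygyMap (h : IsTrimmedRightDoubleOreExtension A p q y₁ y₂ σ) :
    Function.Injective (syzygyMap p q y₁ y₂) := by
  intro r s hrs
  simp only [syzygyMap_apply, Prod.mk.injEq] at hrs
  exact h.bijective_divY₂_comp_mulRight.1 (congrArg h.divY₂ hrs.1)

theorem exact_syzygyMap_combinationMap (h : IsTrimmedRightDoubleOreExtension A p q y₁ y₂ σ) :
    Function.Exact (syzygyMap p q y₁ y₂) (combinationMap y₁ y₂) := by
  rintro ⟨u, v⟩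
  constructor
  · intro huv
    obtain ⟨r, hu, hv⟩ := h.exists_of_mul_add_mul_eq_zero huv
    exact ⟨r, Prod.ext hu hv⟩
  · rintro ⟨r, hr⟩
    rw [← hr, syzygyMap_apply, combinationMap_apply]
    simp [mul_assoc, sub_mul, h.y₂_mul_y₁, pow_two]

end Division

end IsTrimmedRightDoubleOreExtension

namespace IsTrimmedRightDoubleOreExtension

variable {k B : Type*} [Field k] [Ring B] [Algebra k B] {A : Subalgebra k B} {p q : k} {y₁ y₂ : B}
  {σ : A → Matrix (Fin 2) (Fin 2) A}

section Grading

variable {𝒜 : ℕ → Submodule k A}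

theorem smul_monomial_mem_doubleOreGrading {m i j n : ℕ} (hn : m + i + j = n) {a : A}
    (ha : a ∈ 𝒜 m) : a • (y₁ ^ i * y₂ ^ j) ∈ doubleOreGrading A 𝒜 y₁ y₂ n :=
  Submodule.subset_span ⟨m, i, j, hn, a, ha, rfl⟩

theorem coe_mem_doubleOreGrading {n : ℕ} {a : A} (ha : a ∈ 𝒜 n) :
    (a : B) ∈ doubleOreGrading A 𝒜 y₁ y₂ n := by
  simpa [Subalgebra.smul_def] using
    smul_monomial_mem_doubleOreGrading (y₁ := y₁) (y₂ := y₂) (i := 0) (j := 0) rfl ha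

@[elab_as_elim]
theorem doubleOreGrading_induction {n : ℕ}
    {motive : ∀ b ∈ doubleOreGrading A 𝒜 y₁ y₂ n, Prop}
    (zero : motive 0 (zero_mem _))
    (add : ∀ b b' hb hb', motive b hb → motive b' hb' → motive (b + b') (add_mem hb hb'))
    (smul_monomial : ∀ m i j (hn : m + i + j = n) (a : A) (ha : a ∈ 𝒜 m),
      motive (a • (y₁ ^ i * y₂ ^ j)) (smul_monomial_mem_doubleOreGrading hn ha))
    {b : B} (hb : b ∈ doubleOreGrading A 𝒜 y₁ y₂ n) : motive b hb := by
  induction hb using Submodule.closure_induction with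
  | zero => exact zero
  | add b b' hb hb' ihb ihb' => exact add b b' hb hb' ihb ihb'
  | smul_mem c b hb =>
    obtain ⟨m, i, j, hn, a, ha, rfl⟩ := hb
    simpa only [smul_assoc] using! smul_monomial m i j hn (c • a) ((𝒜 m).smul_mem c ha)

theorem mem_doubleOreGrading_iff (h : IsTrimmedRightDoubleOreExtension A p q y₁ y₂ σ) {n : ℕ}
    {b : B} : b ∈ doubleOreGrading A 𝒜 y₁ y₂ n ↔ h.basis.repr b ∈
      finsuppDeg (fun ij => shiftDeg (fun m => (𝒜 m).toAddSubgroup) (ij.1 + ij.2)) n := by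
  constructor <;> intro hb
  · induction hb using doubleOreGrading_induction with
    | zero => simp [zero_mem]
    | add b b' _ _ hb hb' => exact map_add h.basis.repr b b' ▸ add_mem hb hb'
    | smul_monomial m i j hn a ha =>
      rw [← h.basis_apply, map_smul, h.basis.repr_self, Finsupp.smul_single, smul_eq_mul, mul_one]
      exact single_mem_finsuppDeg (mem_shiftDeg_iff.2 (.inr ⟨m, by omega, ha⟩))
  · rw [← h.basis.linearCombination_repr b, Finsupp.linearCombination_apply]
    refine sum_mem fun (i, j) _ => ?_
    obtain hij | ⟨m, hm, hij⟩ := mem_shiftDeg_iff.1 (hb (i, j))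
    · simp [hij]
    · change h.basis.repr b (i, j) • h.basis (i, j) ∈ doubleOreGrading A 𝒜 y₁ y₂ n
      rw [h.basis_apply]
      exact smul_monomial_mem_doubleOreGrading (by omega) hij

theorem isInternal_doubleOreGrading [GradedAlgebra 𝒜]
    (h : IsTrimmedRightDoubleOreExtension A p q y₁ y₂ σ) :
    IsInternal (doubleOreGrading A 𝒜 y₁ y₂) :=
  isInternal_of_addEquiv
    (isInternal_finsuppDeg fun _ => isInternal_shiftDeg (Decomposition.isInternal 𝒜) _)
    h.basis.repr.toAddEquiv fun _ _ => h.mem_doubleOreGrading_iff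

theorem pow_mul_mem_doubleOreGrading {y : B} (hy : ∀ n, ∀ b ∈ doubleOreGrading A 𝒜 y₁ y₂ n,
    y * b ∈ doubleOreGrading A 𝒜 y₁ y₂ (n + 1)) (i : ℕ) {n : ℕ} {b : B}
    (hb : b ∈ doubleOreGrading A 𝒜 y₁ y₂ n) :
    y ^ i * b ∈ doubleOreGrading A 𝒜 y₁ y₂ (n + i) := by
  induction i with
  | zero => simpa using hb
  | succ i ih =>
    rw [pow_succ', mul_assoc]
    exact hy _ _ ih

section GradedMonoid

variable [SetLike.GradedMonoid 𝒜]

theorem monomial_mem_doubleOreGrading (i j : ℕ) :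
    y₁ ^ i * y₂ ^ j ∈ doubleOreGrading A 𝒜 y₁ y₂ (i + j) := by
  simpa using smul_monomial_mem_doubleOreGrading (y₁ := y₁) (y₂ := y₂) (m := 0) (i := i) (j := j)
    (by rw [zero_add]) (SetLike.one_mem_graded 𝒜)

theorem y₁_mem_doubleOreGrading : y₁ ∈ doubleOreGrading A 𝒜 y₁ y₂ 1 := by
  simpa using monomial_mem_doubleOreGrading (𝒜 := 𝒜) (y₁ := y₁) (y₂ := y₂) 1 0

theorem y₂_mem_doubleOreGrading : y₂ ∈ doubleOreGrading A 𝒜 y₁ y₂ 1 := by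
  simpa using monomial_mem_doubleOreGrading (𝒜 := 𝒜) (y₁ := y₁) (y₂ := y₂) 0 1

theorem smul_mem_doubleOreGrading {m n : ℕ} {a : A} {b : B} (ha : a ∈ 𝒜 m)
    (hb : b ∈ doubleOreGrading A 𝒜 y₁ y₂ n) : a • b ∈ doubleOreGrading A 𝒜 y₁ y₂ (m + n) := by
  induction hb using doubleOreGrading_induction with
  | zero => simp
  | add b b' _ _ hb hb' => exact smul_add a b b' ▸ add_mem hb hb'
  | smul_monomial l i j hn a' ha' =>
    rw [smul_smul]
    exact smul_monomial_mem_doubleOreGrading (by omega) (SetLike.mul_mem_graded ha ha')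

theorem y₁_mul_monomial_mem_doubleOreGrading (i j : ℕ) :
    y₁ * (y₁ ^ i * y₂ ^ j) ∈ doubleOreGrading A 𝒜 y₁ y₂ (i + j + 1) := by
  rw [← mul_assoc, ← pow_succ', add_right_comm]
  exact monomial_mem_doubleOreGrading (i + 1) j

theorem y₂_mul_monomial_mem_doubleOreGrading
    (h : IsTrimmedRightDoubleOreExtension A p q y₁ y₂ σ) (i j : ℕ) :
    y₂ * (y₁ ^ i * y₂ ^ j) ∈ doubleOreGrading A 𝒜 y₁ y₂ (i + j + 1) := by
  rw [mul_pow_mul_pow_eq_of_mul_eq h.y₂_mul_y₁]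
  refine add_mem (Submodule.smul_mem _ _ (monomial_mem_doubleOreGrading i (j + 1)))
    (Submodule.smul_mem _ _ ?_)
  rw [add_right_comm]
  exact monomial_mem_doubleOreGrading (i + 1) j

theorem mul_mem_doubleOreGrading_succ (h : IsTrimmedRightDoubleOreExtension A p q y₁ y₂ σ)
    {y : B} {s t : A → A} (hs : ∀ m, ∀ a ∈ 𝒜 m, s a ∈ 𝒜 m) (ht : ∀ m, ∀ a ∈ 𝒜 m, t a ∈ 𝒜 m)
    (hy : ∀ (a : A) b, y * a • b = s a • (y₁ * b) + t a • (y₂ * b)) {n : ℕ} {b : B}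
    (hb : b ∈ doubleOreGrading A 𝒜 y₁ y₂ n) : y * b ∈ doubleOreGrading A 𝒜 y₁ y₂ (n + 1) := by
  induction hb using doubleOreGrading_induction with
  | zero => simp
  | add b b' _ _ hb hb' => exact mul_add y b b' ▸ add_mem hb hb'
  | smul_monomial m i j hn a ha =>
    rw [hy, show n + 1 = m + (i + j + 1) by omega]
    exact add_mem (smul_mem_doubleOreGrading (hs m a ha) (y₁_mul_monomial_mem_doubleOreGrading i j))
      (smul_mem_doubleOreGrading (ht m a ha) (h.y₂_mul_monomial_mem_doubleOreGrading i j))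

theorem gradedMonoid_doubleOreGrading (h : IsTrimmedRightDoubleOreExtension A p q y₁ y₂ σ)
    (hσ : ∀ n, ∀ a ∈ 𝒜 n, ∀ i j, σ a i j ∈ 𝒜 n) :
    SetLike.GradedMonoid (doubleOreGrading A 𝒜 y₁ y₂) where
  one_mem := coe_mem_doubleOreGrading (SetLike.one_mem_graded 𝒜)
  mul_mem m n b b' hb hb' := by
    have hy₁ (n : ℕ) : ∀ c ∈ doubleOreGrading A 𝒜 y₁ y₂ n,
        y₁ * c ∈ doubleOreGrading A 𝒜 y₁ y₂ (n + 1) :=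
      fun c => h.mul_mem_doubleOreGrading_succ (fun m a ha => hσ m a ha 0 0)
        (fun m a ha => hσ m a ha 0 1) h.y₁_mul_smul
    have hy₂ (n : ℕ) : ∀ c ∈ doubleOreGrading A 𝒜 y₁ y₂ n,
        y₂ * c ∈ doubleOreGrading A 𝒜 y₁ y₂ (n + 1) :=
      fun c => h.mul_mem_doubleOreGrading_succ (fun m a ha => hσ m a ha 1 0)
        (fun m a ha => hσ m a ha 1 1) h.y₂_mul_smul
    induction hb using doubleOreGrading_induction with
    | zero => simp
    | add b c _ _ hb hc => exact add_mul b c b' ▸ add_mem hb hc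
    | smul_monomial l i j hm a ha =>
      rw [smul_mul_assoc, mul_assoc, show m + n = l + (n + j + i) by omega]
      exact smul_mem_doubleOreGrading ha
        (pow_mul_mem_doubleOreGrading hy₁ i (pow_mul_mem_doubleOreGrading hy₂ j hb'))

end GradedMonoid

theorem isGradedAlgebra_doubleOreGrading [GradedAlgebra 𝒜]
    (h : IsTrimmedRightDoubleOreExtension A p q y₁ y₂ σ)
    (hσ : ∀ n, ∀ a ∈ 𝒜 n, ∀ i j, σ a i j ∈ 𝒜 n) :
    IsGradedAlgebra (doubleOreGrading A 𝒜 y₁ y₂) :=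
  ⟨{ h.gradedMonoid_doubleOreGrading hσ, h.isInternal_doubleOreGrading.chooseDecomposition with }⟩

end Grading

end IsTrimmedRightDoubleOreExtension

namespace IsTrimmedRightDoubleOreExtension

section ConstCoeff

variable {k B : Type*} [Field k] [Ring B] [Algebra k B] {A : Subalgebra k B} {p q : k} {y₁ y₂ : B}
  {σ : A → Matrix (Fin 2) (Fin 2) A}

theorem coord_one (h : IsTrimmedRightDoubleOreExtension A p q y₁ y₂ σ) :
    h.basis.coord (0, 0) 1 = 1 := by
  have h₁ : h.basis (0, 0) = 1 := by simp [h.basis_apply]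
  simp [← h₁]

theorem coord_monomial (h : IsTrimmedRightDoubleOreExtension A p q y₁ y₂ σ) {i j : ℕ}
    (hij : (i, j) ≠ (0, 0)) : h.basis.coord (0, 0) (y₁ ^ i * y₂ ^ j) = 0 := by
  rw [← h.basis_apply, h.basis.coord_apply, h.basis.repr_self, Finsupp.single_eq_of_ne hij.symm]

theorem coord_y₁_mul_and_coord_y₂_mul (h : IsTrimmedRightDoubleOreExtension A p q y₁ y₂ σ)
    (b : B) : h.basis.coord (0, 0) (y₁ * b) = 0 ∧ h.basis.coord (0, 0) (y₂ * b) = 0 := by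
  refine h.y₁_mul_mem_and_y₂_mul_mem (S := LinearMap.ker (h.basis.coord (0, 0))) ?_ ?_ b
  · intro i j
    rw [← mul_assoc, ← pow_succ']
    exact h.coord_monomial (by simp)
  · intro i j
    rw [mul_pow_mul_pow_eq_of_mul_eq h.y₂_mul_y₁]
    exact add_mem (Submodule.smul_of_tower_mem _ _ (h.coord_monomial (by simp)))
      (Submodule.smul_of_tower_mem _ _ (h.coord_monomial (by simp)))

theorem coord_mul (h : IsTrimmedRightDoubleOreExtension A p q y₁ y₂ σ) (b c : B) :
    h.basis.coord (0, 0) (b * c) = h.basis.coord (0, 0) b * h.basis.coord (0, 0) c := by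
  refine h.mem_of_monomial_mem (S := LinearMap.eqLocus
    (h.basis.coord (0, 0) ∘ₗ LinearMap.mulRight A c)
    (LinearMap.mulRight A (h.basis.coord (0, 0) c) ∘ₗ h.basis.coord (0, 0))) ?_ b
  rintro (_ | i) j
  · obtain _ | j := j
    · simp [-Module.Basis.coord_apply, coord_one]
    · simp [pow_succ', mul_assoc, -Module.Basis.coord_apply, coord_y₁_mul_and_coord_y₂_mul]
  · simp [pow_succ', mul_assoc, -Module.Basis.coord_apply, coord_y₁_mul_and_coord_y₂_mul]

/-- The retraction `B → A` killing `y₁` and `y₂`: it takes the coefficient of the monomial `1`. -/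
noncomputable def constCoeff (h : IsTrimmedRightDoubleOreExtension A p q y₁ y₂ σ) : B →+* A where
  toFun := h.basis.coord (0, 0)
  map_one' := h.coord_one
  map_mul' := h.coord_mul
  map_zero' := map_zero _
  map_add' := map_add _

theorem constCoeff_coe (h : IsTrimmedRightDoubleOreExtension A p q y₁ y₂ σ) (a : A) :
    h.constCoeff a = a := by
  have ha := (h.basis.coord (0, 0)).map_smul a 1
  rwa [h.coord_one, smul_eq_mul, mul_one, Subalgebra.smul_def, smul_eq_mul, mul_one] at ha

theorem constCoeff_y₁ (h : IsTrimmedRightDoubleOreExtension A p q y₁ y₂ σ) :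
    h.constCoeff y₁ = 0 := by
  simpa only [mul_one] using! (h.coord_y₁_mul_and_coord_y₂_mul 1).1

theorem constCoeff_y₂ (h : IsTrimmedRightDoubleOreExtension A p q y₁ y₂ σ) :
    h.constCoeff y₂ = 0 := by
  simpa only [mul_one] using! (h.coord_y₁_mul_and_coord_y₂_mul 1).2

theorem exact_combinationMap_constCoeff (h : IsTrimmedRightDoubleOreExtension A p q y₁ y₂ σ) :
    Function.Exact (combinationMap y₁ y₂) h.constCoeff := by
  let f : B × B →ₗ[A] B := (combinationMap y₁ y₂).restrictScalars A
  let g : B →ₗ[A] B := .id - LinearMap.toSpanSingleton A B 1 ∘ₗ h.basis.coord (0, 0)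
  have hg (b : B) : g b = b - h.constCoeff b :=
    congrArg (b - ·) (mul_one (h.constCoeff b : B))
  have hrange (b : B) : g b ∈ LinearMap.range f := by
    refine h.mem_of_monomial_mem (S := (LinearMap.range f).comap g) ?_ b
    rintro i (_ | j)
    · obtain _ | i := i
      · exact ⟨0, by simp [hg]⟩
      · exact ⟨(y₁ ^ i, 0), by simp [f, combinationMap_apply, hg, constCoeff_y₁, pow_succ]⟩
    · exact ⟨(0, y₁ ^ i * y₂ ^ j), by
        simp [f, combinationMap_apply, hg, constCoeff_y₂, pow_succ, mul_assoc]⟩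
  intro b
  constructor
  · intro hb
    simpa [hg, hb] using! hrange b
  · rintro ⟨⟨u, v⟩, rfl⟩
    simp [combinationMap_apply, constCoeff_y₁, constCoeff_y₂]

theorem constCoeff_mem {𝒜 : ℕ → Submodule k A}
    (h : IsTrimmedRightDoubleOreExtension A p q y₁ y₂ σ) (n : ℕ) (b : B)
    (hb : b ∈ doubleOreGrading A 𝒜 y₁ y₂ n) : h.constCoeff b ∈ 𝒜 n := by
  obtain h₀ | ⟨m, rfl, hm⟩ := mem_shiftDeg_iff.1 (h.mem_doubleOreGrading_iff.1 hb (0, 0))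
  · exact (congrArg (· ∈ 𝒜 n) h₀).mpr (zero_mem _)
  · exact hm

end ConstCoeff

section Linear

open GradedMod

variable {k : Type*} {B : Type u} [Field k] [Ring B] [Algebra k B] {A : Subalgebra k B} {p q : k}
  {y₁ y₂ : B} {σ : A → Matrix (Fin 2) (Fin 2) A} {𝒜 : ℕ → Submodule k A}
  [GradedAlgebra (doubleOreGrading A 𝒜 y₁ y₂)]

theorem isGraded_toSpanSingleton_self {x : B} {i : ℕ}
    (hx : x ∈ doubleOreGrading A 𝒜 y₁ y₂ i) (n : ℕ) :
    IsGraded (M := self (doubleOreGrading A 𝒜 y₁ y₂) (n + i))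
      (N := self (doubleOreGrading A 𝒜 y₁ y₂) n) (LinearMap.toSpanSingleton B B x) :=
  isGraded_toSpanSingleton (mem_shiftDeg_iff.2 (.inr ⟨i, add_comm i n, hx⟩))

variable [GradedAlgebra 𝒜]

/-- The retraction `B(-n) → A(-n)` as a `B`-linear map. -/
noncomputable def constCoeffₗ (h : IsTrimmedRightDoubleOreExtension A p q y₁ y₂ σ)
    (𝒜 : ℕ → Submodule k A) [GradedAlgebra 𝒜] [GradedAlgebra (doubleOreGrading A 𝒜 y₁ y₂)]
    (n : ℕ) : self (doubleOreGrading A 𝒜 y₁ y₂) n →ₗ[B]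
      restrict (h.constCoeff_mem (𝒜 := 𝒜)) (self 𝒜 n) where
  toFun := h.constCoeff
  map_add' := map_add _
  map_smul' := h.constCoeff.map_mul

theorem isGraded_constCoeffₗ (h : IsTrimmedRightDoubleOreExtension A p q y₁ y₂ σ) (n : ℕ) :
    IsGraded (h.constCoeffₗ 𝒜 n) := by
  intro m b hb
  obtain rfl | ⟨l, rfl, hbl⟩ := mem_shiftDeg_iff.1 hb
  · simp
  · exact mem_shiftDeg_iff.2 (.inr ⟨l, rfl, h.constCoeff_mem l b hbl⟩)

theorem isGraded_combinationMap (n : ℕ) :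
    IsGraded (M := (self (doubleOreGrading A 𝒜 y₁ y₂) (n + 1)).prod
      (self (doubleOreGrading A 𝒜 y₁ y₂) (n + 1))) (N := self (doubleOreGrading A 𝒜 y₁ y₂) n)
      (combinationMap y₁ y₂) :=
  fun m uv huv => add_mem (isGraded_toSpanSingleton_self y₁_mem_doubleOreGrading n m uv.1 huv.1)
    (isGraded_toSpanSingleton_self y₂_mem_doubleOreGrading n m uv.2 huv.2)

theorem isGraded_syzygyMap (p q : k) (n : ℕ) :
    IsGraded (M := self (doubleOreGrading A 𝒜 y₁ y₂) (n + 2))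
      (N := (self (doubleOreGrading A 𝒜 y₁ y₂) (n + 1)).prod
        (self (doubleOreGrading A 𝒜 y₁ y₂) (n + 1))) (syzygyMap p q y₁ y₂) :=
  fun m r hr => ⟨isGraded_toSpanSingleton_self (sub_mem y₂_mem_doubleOreGrading
      (Submodule.smul_mem _ q y₁_mem_doubleOreGrading)) (n + 1) m r hr,
    isGraded_toSpanSingleton_self (neg_mem (Submodule.smul_mem _ p y₁_mem_doubleOreGrading))
      (n + 1) m r hr⟩

theorem shortExact_ker_constCoeffₗ (h : IsTrimmedRightDoubleOreExtension A p q y₁ y₂ σ) (n : ℕ) :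
    ShortExact (self (doubleOreGrading A 𝒜 y₁ y₂) (n + 2))
      ((self (doubleOreGrading A 𝒜 y₁ y₂) (n + 1)).prod
        (self (doubleOreGrading A 𝒜 y₁ y₂) (n + 1)))
      (ker (h.constCoeffₗ 𝒜 n) (h.isGraded_constCoeffₗ n)) := by
  refine ⟨syzygyMap p q y₁ y₂, (combinationMap y₁ y₂).codRestrict
    (LinearMap.ker (h.constCoeffₗ 𝒜 n)) h.exact_combinationMap_constCoeff.apply_apply_eq_zero,
    isGraded_syzygyMap p q n, isGraded_combinationMap n, h.injective_syzygyMap,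
    fun uv => Subtype.ext_iff.trans (h.exact_syzygyMap_combinationMap uv), ?_⟩
  rintro ⟨b, hb⟩
  obtain ⟨uv, rfl⟩ := (h.exact_combinationMap_constCoeff b).1 hb
  exact ⟨uv, rfl⟩

theorem isLinear_restrict_self (h : IsTrimmedRightDoubleOreExtension A p q y₁ y₂ σ) (n : ℕ) :
    IsLinear n (restrict (h.constCoeff_mem (𝒜 := 𝒜)) (self 𝒜 n)) :=
  isLinear_iff_hasLinearCover.2 ⟨_, _, isFreeInDegree_self n,
    isLinear_iff_hasLinearCover.2 ⟨_, _, (isFreeInDegree_self _).prod (isFreeInDegree_self _),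
      (isFreeInDegree_self _).isLinear, h.shortExact_ker_constCoeffₗ n⟩,
    shortExact_ker (h.isGraded_constCoeffₗ n) fun (a : A) => ⟨(a : B), h.constCoeff_coe a⟩⟩

end Linear

section TrivialModule

open GradedMod

theorem constCoeff_mem_augmentationIdeal_iff {k B : Type*} [Field k] [Ring B] [Algebra k B]
    {A : Subalgebra k B} {p q : k} {y₁ y₂ : B} {σ : A → Matrix (Fin 2) (Fin 2) A}
    {𝒜 : ℕ → Submodule k A} [SetLike.GradedMonoid 𝒜]
    (h : IsTrimmedRightDoubleOreExtension A p q y₁ y₂ σ) {b : B} :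
    h.constCoeff b ∈ augmentationIdeal 𝒜 ↔
      b ∈ augmentationIdeal (doubleOreGrading A 𝒜 y₁ y₂) := by
  have hle : augmentationIdeal (doubleOreGrading A 𝒜 y₁ y₂) ≤
      (augmentationIdeal 𝒜).comap h.constCoeff.toSemilinearMap :=
    Submodule.span_le.2 fun b ⟨n, hn, hb⟩ => Submodule.subset_span ⟨n, hn, h.constCoeff_mem n b hb⟩
  have hcoe : augmentationIdeal 𝒜 ≤
      (augmentationIdeal (doubleOreGrading A 𝒜 y₁ y₂)).comap
        (A.val : A →+* B).toSemilinearMap :=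
    Submodule.span_le.2 fun a ⟨n, hn, ha⟩ =>
      Submodule.subset_span ⟨n, hn, coe_mem_doubleOreGrading ha⟩
  refine ⟨fun hb => ?_, fun hb => hle hb⟩
  have hker : h.constCoeff (b - h.constCoeff b) = 0 := by
    rw [map_sub, h.constCoeff_coe, sub_self]
  obtain ⟨⟨u, v⟩, huv⟩ := (h.exact_combinationMap_constCoeff _).1 hker
  rw [← sub_add_cancel b (h.constCoeff b), ← huv, combinationMap_apply]
  exact add_mem (add_mem
    (Submodule.smul_mem _ u (Submodule.subset_span ⟨1, le_rfl, y₁_mem_doubleOreGrading⟩))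
    (Submodule.smul_mem _ v (Submodule.subset_span ⟨1, le_rfl, y₂_mem_doubleOreGrading⟩)))
    (hcoe hb)

variable {k : Type*} {B : Type u} [Field k] [Ring B] [Algebra k B] {A : Subalgebra k B} {p q : k}
  {y₁ y₂ : B} {σ : A → Matrix (Fin 2) (Fin 2) A} {𝒜 : ℕ → Submodule k A}
  [GradedAlgebra 𝒜] [GradedAlgebra (doubleOreGrading A 𝒜 y₁ y₂)]

/-- The identification of the trivial `B`-module with the trivial `A`-module, restricted along the
retraction `B → A`. -/
noncomputable def trivialMap (h : IsTrimmedRightDoubleOreExtension A p q y₁ y₂ σ)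
    (𝒜 : ℕ → Submodule k A) [GradedAlgebra 𝒜]
    [GradedAlgebra (doubleOreGrading A 𝒜 y₁ y₂)] :
    trivial (doubleOreGrading A 𝒜 y₁ y₂) →ₗ[B]
      restrict (h.constCoeff_mem (𝒜 := 𝒜)) (trivial 𝒜) :=
  let f := (augmentationIdeal (doubleOreGrading A 𝒜 y₁ y₂)).mapQ (augmentationIdeal 𝒜)
    h.constCoeff.toSemilinearMap fun _ => h.constCoeff_mem_augmentationIdeal_iff.2
  { toFun := f
    map_add' := f.map_add
    map_smul' := f.map_smulₛₗ }

theorem bijective_trivialMap (h : IsTrimmedRightDoubleOreExtension A p q y₁ y₂ σ) :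
    Function.Bijective (h.trivialMap 𝒜) := by
  constructor
  · refine (injective_iff_map_eq_zero _).2 fun x hx => ?_
    obtain ⟨b, rfl⟩ := Submodule.Quotient.mk_surjective _ x
    exact (Submodule.Quotient.mk_eq_zero _).2
      (h.constCoeff_mem_augmentationIdeal_iff.1 ((Submodule.Quotient.mk_eq_zero _).1 hx))
  · intro x
    obtain ⟨a, rfl⟩ := Submodule.Quotient.mk_surjective _ x
    exact ⟨Submodule.Quotient.mk (a : B),
      congrArg (Submodule.Quotient.mk (p := augmentationIdeal 𝒜)) (h.constCoeff_coe a)⟩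

theorem isLinear_trivial (h : IsTrimmedRightDoubleOreExtension A p q y₁ y₂ σ)
    (h𝒜 : IsLinear 0 (trivial 𝒜)) : IsLinear 0 (trivial (doubleOreGrading A 𝒜 y₁ y₂)) := by
  let e := LinearEquiv.ofBijective (h.trivialMap 𝒜) h.bijective_trivialMap
  refine (IsLinear.restrict h.isLinear_restrict_self h𝒜).of_bijective
    (e := e.symm.toLinearMap) ?_ e.symm.bijective
  exact fun m x hx => mem_trivial_deg_iff.2 fun hm =>
    (congrArg e.symm (mem_trivial_deg_iff.1 hx hm)).trans (map_zero e.symm)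

end TrivialModule

end IsTrimmedRightDoubleOreExtension

namespace IsTrimmedRightDoubleOreExtension

section Lift

variable {k B Q : Type*} [Field k] [Ring B] [Algebra k B] [Ring Q] [Algebra k Q]
  {A : Subalgebra k B} {p q : k} {y₁ y₂ : B} {σ : A → Matrix (Fin 2) (Fin 2) A}
  {α : A →ₐ[k] Q} {z₁ z₂ : Q} {S : Set A}

/-- The linear map `B → Q` sending `a • (y₁ ^ i * y₂ ^ j)` to `α a * (z₁ ^ i * z₂ ^ j)`. It is the
candidate for an algebra homomorphism extending `α` and sending `y₁` and `y₂` to `z₁` and `z₂`. -/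
noncomputable def liftₗ (h : IsTrimmedRightDoubleOreExtension A p q y₁ y₂ σ) (α : A →ₐ[k] Q)
    (z₁ z₂ : Q) : B →ₗ[k] Q :=
  Finsupp.lsum k (fun ij => LinearMap.mulRight k (z₁ ^ ij.1 * z₂ ^ ij.2) ∘ₗ α.toLinearMap) ∘ₗ
    (h.basis.repr.restrictScalars k).toLinearMap

theorem liftₗ_smul_monomial (h : IsTrimmedRightDoubleOreExtension A p q y₁ y₂ σ) (a : A)
    (i j : ℕ) : h.liftₗ α z₁ z₂ (a • (y₁ ^ i * y₂ ^ j)) = α a * (z₁ ^ i * z₂ ^ j) := by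
  simp [liftₗ, ← h.basis_apply, mul_assoc]

theorem liftₗ_monomial (h : IsTrimmedRightDoubleOreExtension A p q y₁ y₂ σ) (i j : ℕ) :
    h.liftₗ α z₁ z₂ (y₁ ^ i * y₂ ^ j) = z₁ ^ i * z₂ ^ j := by
  simpa using h.liftₗ_smul_monomial (α := α) (z₁ := z₁) (z₂ := z₂) 1 i j

theorem liftₗ_smul (h : IsTrimmedRightDoubleOreExtension A p q y₁ y₂ σ) (a : A) (b : B) :
    h.liftₗ α z₁ z₂ (a • b) = α a * h.liftₗ α z₁ z₂ b := by
  let T : Submodule A B :=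
    { carrier := {b | ∀ a : A, h.liftₗ α z₁ z₂ (a • b) = α a * h.liftₗ α z₁ z₂ b}
      zero_mem' := by simp
      add_mem' := fun hb hc a => by rw [smul_add, map_add, map_add, mul_add, hb a, hc a]
      smul_mem' := fun a' b hb a => by rw [smul_smul, hb, hb, map_mul, mul_assoc] }
  refine h.mem_of_monomial_mem (S := T) (fun i j a => ?_) b a
  rw [h.liftₗ_smul_monomial, h.liftₗ_monomial]

theorem liftₗ_y₁_mul_and_liftₗ_y₂_mul (h : IsTrimmedRightDoubleOreExtension A p q y₁ y₂ σ)
    (hz : z₂ * z₁ = p • (z₁ * z₂) + q • z₁ ^ 2) (hS : Algebra.adjoin k S = ⊤)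
    (hz₁ : ∀ a ∈ S, z₁ * α a = α (σ a 0 0) * z₁ + α (σ a 0 1) * z₂)
    (hz₂ : ∀ a ∈ S, z₂ * α a = α (σ a 1 0) * z₁ + α (σ a 1 1) * z₂) (b : B) :
    h.liftₗ α z₁ z₂ (y₁ * b) = z₁ * h.liftₗ α z₁ z₂ b ∧
      h.liftₗ α z₁ z₂ (y₂ * b) = z₂ * h.liftₗ α z₁ z₂ b := by
  let s := h.liftₗ α z₁ z₂
  let N : Submodule k B :=
    LinearMap.eqLocus (s ∘ₗ LinearMap.mulLeft k y₁) (LinearMap.mulLeft k z₁ ∘ₗ s) ⊓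
      LinearMap.eqLocus (s ∘ₗ LinearMap.mulLeft k y₂) (LinearMap.mulLeft k z₂ ∘ₗ s)
  have hN (a : A) : ∀ b ∈ N, a • b ∈ N := by
    have ha : a ∈ Algebra.adjoin k S := hS ▸ trivial
    induction ha using Algebra.adjoin_induction with
    | mem a ha =>
      rintro b ⟨hb₁ : s (y₁ * b) = z₁ * s b, hb₂ : s (y₂ * b) = z₂ * s b⟩
      constructor
      · change s (y₁ * a • b) = z₁ * s (a • b)
        rw [h.y₁_mul_smul, map_add, h.liftₗ_smul, h.liftₗ_smul, hb₁, hb₂, h.liftₗ_smul,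
          ← mul_assoc z₁, hz₁ a ha, add_mul, mul_assoc, mul_assoc]
      · change s (y₂ * a • b) = z₂ * s (a • b)
        rw [h.y₂_mul_smul, map_add, h.liftₗ_smul, h.liftₗ_smul, hb₁, hb₂, h.liftₗ_smul,
          ← mul_assoc z₂, hz₂ a ha, add_mul, mul_assoc, mul_assoc]
    | algebraMap c => exact fun b hb => algebraMap_smul A c b ▸ N.smul_mem c hb
    | add a a' _ _ ha ha' => exact fun b hb => add_smul a a' b ▸ add_mem (ha b hb) (ha' b hb)
    | mul a a' _ _ ha ha' => exact fun b hb => mul_smul a a' b ▸ ha _ (ha' b hb)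
  refine h.mem_of_monomial_mem (S := { N with smul_mem' := hN }) (fun i j => ⟨?_, ?_⟩) b
  · change s (y₁ * (y₁ ^ i * y₂ ^ j)) = z₁ * s (y₁ ^ i * y₂ ^ j)
    rw [h.liftₗ_monomial, ← mul_assoc, ← pow_succ', h.liftₗ_monomial, ← mul_assoc, ← pow_succ']
  · change s (y₂ * (y₁ ^ i * y₂ ^ j)) = z₂ * s (y₁ ^ i * y₂ ^ j)
    simp only [mul_pow_mul_pow_eq_of_mul_eq h.y₂_mul_y₁, map_add, map_smul, s, h.liftₗ_monomial,
      mul_pow_mul_pow_eq_of_mul_eq hz]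

theorem liftₗ_mul (h : IsTrimmedRightDoubleOreExtension A p q y₁ y₂ σ)
    (hy₁ : ∀ b, h.liftₗ α z₁ z₂ (y₁ * b) = z₁ * h.liftₗ α z₁ z₂ b)
    (hy₂ : ∀ b, h.liftₗ α z₁ z₂ (y₂ * b) = z₂ * h.liftₗ α z₁ z₂ b) (b c : B) :
    h.liftₗ α z₁ z₂ (b * c) = h.liftₗ α z₁ z₂ b * h.liftₗ α z₁ z₂ c := by
  let s := h.liftₗ α z₁ z₂
  have hpow {y : B} {z : Q} (hy : ∀ b, s (y * b) = z * s b) (n : ℕ) (b : B) :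
      s (y ^ n * b) = z ^ n * s b := by
    induction n with
    | zero => simp
    | succ n ih => rw [pow_succ', mul_assoc, hy, ih, pow_succ', mul_assoc]
  let T : Submodule A B :=
    { carrier := {b | s (b * c) = s b * s c}
      zero_mem' := by simp
      add_mem' := fun {b b'} hb hb' => by
        rw [Set.mem_ofPred_eq, add_mul, map_add, map_add, add_mul, hb, hb']
      smul_mem' := fun a b hb => by
        rw [Set.mem_ofPred_eq, smul_mul_assoc, h.liftₗ_smul, h.liftₗ_smul, hb, mul_assoc] }
  refine h.mem_of_monomial_mem (S := T) (fun i j => ?_) b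
  change s (y₁ ^ i * y₂ ^ j * c) = s (y₁ ^ i * y₂ ^ j) * s c
  rw [mul_assoc, hpow hy₁, hpow hy₂, h.liftₗ_monomial, mul_assoc]

theorem exists_algHom (h : IsTrimmedRightDoubleOreExtension A p q y₁ y₂ σ)
    (hz : z₂ * z₁ = p • (z₁ * z₂) + q • z₁ ^ 2) (hS : Algebra.adjoin k S = ⊤)
    (hz₁ : ∀ a ∈ S, z₁ * α a = α (σ a 0 0) * z₁ + α (σ a 0 1) * z₂)
    (hz₂ : ∀ a ∈ S, z₂ * α a = α (σ a 1 0) * z₁ + α (σ a 1 1) * z₂) :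
    ∃ f : B →ₐ[k] Q, (∀ a : A, f a = α a) ∧ f y₁ = z₁ ∧ f y₂ = z₂ := by
  have hs_mul := h.liftₗ_mul
    (fun b => (h.liftₗ_y₁_mul_and_liftₗ_y₂_mul hz hS hz₁ hz₂ b).1)
    (fun b => (h.liftₗ_y₁_mul_and_liftₗ_y₂_mul hz hS hz₁ hz₂ b).2)
  have hs := h.liftₗ_monomial (α := α) (z₁ := z₁) (z₂ := z₂)
  have hs_one : h.liftₗ α z₁ z₂ 1 = 1 := by simpa using hs 0 0
  refine ⟨.ofLinearMap (h.liftₗ α z₁ z₂) hs_one hs_mul, fun a => ?_, ?_, ?_⟩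
  · simpa [Subalgebra.smul_def] using
      h.liftₗ_smul_monomial (α := α) (z₁ := z₁) (z₂ := z₂) a 0 0
  · simpa using hs 1 0
  · simpa using hs 0 1

end Lift

end IsTrimmedRightDoubleOreExtension

section QuadraticAlgebra

variable {k A Q : Type*} [Field k] [Ring A] [Algebra k A] [Ring Q] [Algebra k Q]
  {𝒜 : ℕ → Submodule k A}

theorem tensorToAlgebra_ι (𝒜 : ℕ → Submodule k A) (a : 𝒜 1) :
    tensorToAlgebra 𝒜 (TensorAlgebra.ι k a) = a :=
  TensorAlgebra.lift_ι_apply _ _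

theorem surjective_tensorToAlgebra_iff :
    Function.Surjective (tensorToAlgebra 𝒜) ↔ Algebra.adjoin k (𝒜 1 : Set A) = ⊤ := by
  rw [← AlgHom.range_eq_top, tensorToAlgebra, TensorAlgebra.range_lift, Submodule.coe_subtype,
    Subtype.range_coe]

/-- The quadratic relations between the elements of degree `1` of a graded algebra. -/
noncomputable def quadraticRelations (𝒜 : ℕ → Submodule k A) :
    Submodule k (TensorAlgebra k (𝒜 1)) :=
  LinearMap.range (TensorAlgebra.ι k (M := 𝒜 1)) ^ 2 ⊓
    LinearMap.ker (tensorToAlgebra 𝒜).toLinearMap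

theorem ι_mul_ι_mem_range_ι_pow_two {V : Type*} [AddCommGroup V] [Module k V] (v w : V) :
    TensorAlgebra.ι k v * TensorAlgebra.ι k w ∈
      LinearMap.range (TensorAlgebra.ι k (M := V)) ^ 2 :=
  pow_two (LinearMap.range (TensorAlgebra.ι k (M := V))) ▸
    Submodule.mul_mem_mul (LinearMap.mem_range_self _ v) (LinearMap.mem_range_self _ w)

theorem map_eq_map_of_tensorToAlgebra_eq {φ : TensorAlgebra k (𝒜 1) →ₐ[k] Q}
    (hφ : quadraticRelations 𝒜 ≤ LinearMap.ker φ.toLinearMap) {s t : TensorAlgebra k (𝒜 1)}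
    (hs : s ∈ LinearMap.range (TensorAlgebra.ι k (M := 𝒜 1)) ^ 2)
    (ht : t ∈ LinearMap.range (TensorAlgebra.ι k (M := 𝒜 1)) ^ 2)
    (hst : tensorToAlgebra 𝒜 s = tensorToAlgebra 𝒜 t) : φ s = φ t :=
  LinearMap.sub_mem_ker_iff.1
    (hφ ⟨sub_mem hs ht, LinearMap.sub_mem_ker_iff.2 hst⟩)

theorem IsQuadraticAlgebra.exists_algHom (h𝒜 : IsQuadraticAlgebra 𝒜)
    {φ : TensorAlgebra k (𝒜 1) →ₐ[k] Q}
    (hφ : quadraticRelations 𝒜 ≤ LinearMap.ker φ.toLinearMap) :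
    ∃ α : A →ₐ[k] Q, α.comp (tensorToAlgebra 𝒜) = φ := by
  obtain ⟨R, hR, hRA⟩ := h𝒜.relations
  have hspan : TwoSidedIdeal.span (R : Set (TensorAlgebra k (𝒜 1))) ≤ TwoSidedIdeal.ker φ :=
    TwoSidedIdeal.span_le.2 fun r hr => (TwoSidedIdeal.mem_ker _).2
      (hφ ⟨hR hr, (hRA r).2 (TwoSidedIdeal.subset_span hr)⟩)
  have hker : RingHom.ker (tensorToAlgebra 𝒜).toRingHom ≤ RingHom.ker φ.toRingHom :=
    fun t ht => (TwoSidedIdeal.mem_ker φ).1 (hspan ((hRA t).1 ht))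
  let α := (tensorToAlgebra 𝒜).toRingHom.liftOfSurjective h𝒜.generated ⟨φ.toRingHom, hker⟩
  have hα (t : TensorAlgebra k (𝒜 1)) : α (tensorToAlgebra 𝒜 t) = φ t :=
    RingHom.liftOfRightInverse_comp_apply _ _ _ ⟨φ.toRingHom, hker⟩ t
  exact ⟨{ α with commutes' := fun c => by simpa using! hα (algebraMap k _ c) },
    AlgHom.ext hα⟩

theorem tensorToAlgebra_eq_zero_iff_of_exists_algHom
    (h𝒜 : ∀ φ : TensorAlgebra k (𝒜 1) →ₐ[k]
        (TwoSidedIdeal.span (quadraticRelations 𝒜 : Set (TensorAlgebra k (𝒜 1)))).ringCon.Quotient,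
      quadraticRelations 𝒜 ≤ LinearMap.ker φ.toLinearMap →
        ∃ f : A →ₐ[k] _, f.comp (tensorToAlgebra 𝒜) = φ) {t : TensorAlgebra k (𝒜 1)} :
    tensorToAlgebra 𝒜 t = 0 ↔
      t ∈ TwoSidedIdeal.span (quadraticRelations 𝒜 : Set (TensorAlgebra k (𝒜 1))) := by
  let I := TwoSidedIdeal.span (quadraticRelations 𝒜 : Set (TensorAlgebra k (𝒜 1)))
  have hIker : I ≤ TwoSidedIdeal.ker (tensorToAlgebra 𝒜) :=
    TwoSidedIdeal.span_le.2 fun r hr => (TwoSidedIdeal.mem_ker _).2 hr.2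
  let π := I.ringCon.mkₐ (α := k)
  have hπ (s : TensorAlgebra k (𝒜 1)) : π s = 0 ↔ s ∈ I := by
    conv_rhs => rw [← TwoSidedIdeal.ker_ringCon_mk' I, TwoSidedIdeal.mem_ker]
    rfl
  obtain ⟨f, hf⟩ := h𝒜 π fun r hr => (hπ r).2 (TwoSidedIdeal.subset_span hr)
  refine ⟨fun ht => (hπ t).1 ?_, fun ht => (TwoSidedIdeal.mem_ker _).1 (hIker ht)⟩
  rw [← hf, AlgHom.comp_apply, ht, map_zero]

end QuadraticAlgebra

namespace IsTrimmedRightDoubleOreExtension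

variable {k B : Type*} [Field k] [Ring B] [Algebra k B] {A : Subalgebra k B} {p q : k} {y₁ y₂ : B}
  {σ : A → Matrix (Fin 2) (Fin 2) A} {𝒜 : ℕ → Submodule k A}

theorem doubleOreGrading_zero (h0 : 𝒜 0 = LinearMap.range (Algebra.linearMap k A)) :
    doubleOreGrading A 𝒜 y₁ y₂ 0 = LinearMap.range (Algebra.linearMap k B) := by
  apply le_antisymm
  · refine Submodule.span_le.2 ?_
    rintro _ ⟨m, i, j, hm, a, ha, rfl⟩
    obtain ⟨rfl, rfl, rfl⟩ : m = 0 ∧ i = 0 ∧ j = 0 := by omega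
    obtain ⟨c, rfl⟩ := h0 ▸ ha
    exact ⟨c, by simp⟩
  · rintro _ ⟨c, rfl⟩
    exact coe_mem_doubleOreGrading (h0 ▸ ⟨c, rfl⟩ : algebraMap k A c ∈ 𝒜 0)

theorem doubleOreGrading_one_le (h0 : 𝒜 0 = LinearMap.range (Algebra.linearMap k A)) :
    doubleOreGrading A 𝒜 y₁ y₂ 1 ≤
      (𝒜 1).map A.val.toLinearMap ⊔ Submodule.span k {y₁, y₂} := by
  have hscalar (a : A) (ha : a ∈ 𝒜 0) {y : B} (hy : y ∈ ({y₁, y₂} : Set B)) :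
      (a : B) * y ∈ Submodule.span k {y₁, y₂} := by
    obtain ⟨c, rfl⟩ := h0 ▸ ha
    exact Algebra.smul_def c y ▸ Submodule.smul_mem _ c (Submodule.subset_span hy)
  refine Submodule.span_le.2 ?_
  rintro _ ⟨m, i, j, hm, a, ha, rfl⟩
  obtain ⟨rfl, rfl, rfl⟩ | ⟨rfl, rfl, rfl⟩ | ⟨rfl, rfl, rfl⟩ :
      (m = 1 ∧ i = 0 ∧ j = 0) ∨ (m = 0 ∧ i = 1 ∧ j = 0) ∨ (m = 0 ∧ i = 0 ∧ j = 1) := by omega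
  · exact Submodule.mem_sup_left ⟨a, ha, by simp⟩
  · exact Submodule.mem_sup_right (by simpa using hscalar a ha (y := y₁) (by simp))
  · exact Submodule.mem_sup_right (by simpa using hscalar a ha (y := y₂) (by simp))

theorem finiteDimensional_doubleOreGrading_one
    (h0 : 𝒜 0 = LinearMap.range (Algebra.linearMap k A)) [FiniteDimensional k (𝒜 1)] :
    FiniteDimensional k (doubleOreGrading A 𝒜 y₁ y₂ 1) :=
  have : FiniteDimensional k (Submodule.span k {y₁, y₂} : Submodule k B) :=
    FiniteDimensional.span_of_finite k (by simp)
  Submodule.finiteDimensional_of_le (doubleOreGrading_one_le h0)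

theorem adjoin_doubleOreGrading_one [SetLike.GradedMonoid 𝒜]
    (h : IsTrimmedRightDoubleOreExtension A p q y₁ y₂ σ)
    (h𝒜 : Algebra.adjoin k (𝒜 1 : Set A) = ⊤) :
    Algebra.adjoin k (doubleOreGrading A 𝒜 y₁ y₂ 1 : Set B) = ⊤ := by
  have hA : (⊤ : Subalgebra k A).map A.val ≤
      Algebra.adjoin k (doubleOreGrading A 𝒜 y₁ y₂ 1 : Set B) := by
    rw [← h𝒜, AlgHom.map_adjoin]
    exact Algebra.adjoin_mono (Set.image_subset_iff.2 fun a ha => coe_mem_doubleOreGrading ha)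
  rw [eq_top_iff, ← h.generated, Algebra.adjoin_le_iff, Set.union_subset_iff, Set.pair_subset_iff]
  exact ⟨fun a ha => hA ⟨⟨a, ha⟩, trivial, rfl⟩, Algebra.subset_adjoin y₁_mem_doubleOreGrading,
    Algebra.subset_adjoin y₂_mem_doubleOreGrading⟩

/-- The inclusion of `A₁` into `B₁`. -/
def degreeOneInclusion (A : Subalgebra k B) (𝒜 : ℕ → Submodule k A) (y₁ y₂ : B) :
    𝒜 1 →ₗ[k] doubleOreGrading A 𝒜 y₁ y₂ 1 :=
  (A.val.toLinearMap ∘ₗ (𝒜 1).subtype).codRestrict _ fun a => coe_mem_doubleOreGrading a.2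

/-- The homomorphism of tensor algebras induced by the inclusion of `A₁` into `B₁`, along which
relations of `A` become relations of `B`. -/
noncomputable def tensorInclusion (A : Subalgebra k B) (𝒜 : ℕ → Submodule k A) (y₁ y₂ : B) :
    TensorAlgebra k (𝒜 1) →ₐ[k] TensorAlgebra k (doubleOreGrading A 𝒜 y₁ y₂ 1) :=
  TensorAlgebra.lift k (TensorAlgebra.ι k ∘ₗ degreeOneInclusion A 𝒜 y₁ y₂)

theorem tensorInclusion_ι (a : 𝒜 1) : tensorInclusion A 𝒜 y₁ y₂ (TensorAlgebra.ι k a) =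
    TensorAlgebra.ι k (degreeOneInclusion A 𝒜 y₁ y₂ a) :=
  TensorAlgebra.lift_ι_apply _ _

theorem tensorToAlgebra_tensorInclusion (t : TensorAlgebra k (𝒜 1)) :
    tensorToAlgebra (doubleOreGrading A 𝒜 y₁ y₂) (tensorInclusion A 𝒜 y₁ y₂ t) =
      tensorToAlgebra 𝒜 t := by
  have hcomp : (tensorToAlgebra (doubleOreGrading A 𝒜 y₁ y₂)).comp (tensorInclusion A 𝒜 y₁ y₂) =
      A.val.comp (tensorToAlgebra 𝒜) := TensorAlgebra.hom_ext <| LinearMap.ext fun a => by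
    simp only [LinearMap.comp_apply, AlgHom.toLinearMap_apply, AlgHom.comp_apply,
      tensorInclusion_ι, tensorToAlgebra_ι]
    rfl
  exact DFunLike.congr_fun hcomp t

theorem quadraticRelations_le_comap_tensorInclusion :
    quadraticRelations 𝒜 ≤ (quadraticRelations (doubleOreGrading A 𝒜 y₁ y₂)).comap
      (tensorInclusion A 𝒜 y₁ y₂).toLinearMap := by
  have hpow : LinearMap.range (TensorAlgebra.ι k (M := 𝒜 1)) ^ 2 ≤
      (LinearMap.range (TensorAlgebra.ι k (M := doubleOreGrading A 𝒜 y₁ y₂ 1)) ^ 2).comap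
        (tensorInclusion A 𝒜 y₁ y₂).toLinearMap := by
    rw [pow_two, Submodule.mul_le]
    rintro _ ⟨a, rfl⟩ _ ⟨b, rfl⟩
    simpa only [Submodule.mem_comap, AlgHom.toLinearMap_apply, map_mul, tensorInclusion_ι] using
      ι_mul_ι_mem_range_ι_pow_two _ _
  intro t ht
  refine ⟨hpow ht.1, ?_⟩
  have ht0 : tensorToAlgebra 𝒜 t = 0 := ht.2
  simpa [ht0] using tensorToAlgebra_tensorInclusion (y₁ := y₁) (y₂ := y₂) t

theorem algHom_tensorAlgebra_ext [SetLike.GradedMonoid 𝒜] {Q : Type*} [Ring Q] [Algebra k Q]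
    (h0 : 𝒜 0 = LinearMap.range (Algebra.linearMap k A))
    {φ ψ : TensorAlgebra k (doubleOreGrading A 𝒜 y₁ y₂ 1) →ₐ[k] Q}
    (hA : φ.comp (tensorInclusion A 𝒜 y₁ y₂) = ψ.comp (tensorInclusion A 𝒜 y₁ y₂))
    (hy₁ : φ (TensorAlgebra.ι k ⟨y₁, y₁_mem_doubleOreGrading⟩) =
      ψ (TensorAlgebra.ι k ⟨y₁, y₁_mem_doubleOreGrading⟩))
    (hy₂ : φ (TensorAlgebra.ι k ⟨y₂, y₂_mem_doubleOreGrading⟩) =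
      ψ (TensorAlgebra.ι k ⟨y₂, y₂_mem_doubleOreGrading⟩)) : φ = ψ := by
  refine TensorAlgebra.hom_ext (LinearMap.ext fun ⟨b, hb⟩ => ?_)
  obtain ⟨_, ⟨a, ha, rfl⟩, z, hz, hb'⟩ := Submodule.mem_sup.1 (doubleOreGrading_one_le h0 hb)
  obtain ⟨c, d, rfl⟩ := Submodule.mem_span_pair.1 hz
  have hsplit : (⟨b, hb⟩ : doubleOreGrading A 𝒜 y₁ y₂ 1) =
      degreeOneInclusion A 𝒜 y₁ y₂ ⟨a, ha⟩ + (c • ⟨y₁, y₁_mem_doubleOreGrading⟩ +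
        d • ⟨y₂, y₂_mem_doubleOreGrading⟩) := Subtype.ext hb'.symm
  have ha' := DFunLike.congr_fun hA (TensorAlgebra.ι k ⟨a, ha⟩)
  simp only [AlgHom.comp_apply, tensorInclusion_ι] at ha'
  simp only [hsplit, map_add, map_smul, LinearMap.comp_apply, AlgHom.toLinearMap_apply, ha', hy₁,
    hy₂]

section UniversalProperty

variable {Q : Type*} [Ring Q] [Algebra k Q]
  {φ : TensorAlgebra k (doubleOreGrading A 𝒜 y₁ y₂ 1) →ₐ[k] Q}

theorem map_ι_mul_map_tensorInclusion_ι [SetLike.GradedMonoid 𝒜]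
    (hφ : quadraticRelations (doubleOreGrading A 𝒜 y₁ y₂) ≤ LinearMap.ker φ.toLinearMap)
    (y : doubleOreGrading A 𝒜 y₁ y₂ 1) (a s t : 𝒜 1)
    (hy : (y : B) * (a : A) = (s : A) * y₁ + (t : A) * y₂) :
    φ (TensorAlgebra.ι k y) * φ (tensorInclusion A 𝒜 y₁ y₂ (TensorAlgebra.ι k a)) =
      φ (tensorInclusion A 𝒜 y₁ y₂ (TensorAlgebra.ι k s)) *
          φ (TensorAlgebra.ι k ⟨y₁, y₁_mem_doubleOreGrading⟩) +
        φ (tensorInclusion A 𝒜 y₁ y₂ (TensorAlgebra.ι k t)) *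
          φ (TensorAlgebra.ι k ⟨y₂, y₂_mem_doubleOreGrading⟩) := by
  simp only [← map_mul, ← map_add]
  refine map_eq_map_of_tensorToAlgebra_eq hφ ?_ ?_ ?_
  · simpa only [tensorInclusion_ι] using ι_mul_ι_mem_range_ι_pow_two _ _
  · simpa only [tensorInclusion_ι] using
      add_mem (ι_mul_ι_mem_range_ι_pow_two _ _) (ι_mul_ι_mem_range_ι_pow_two _ _)
  · simpa only [map_add, map_mul, tensorToAlgebra_tensorInclusion, tensorToAlgebra_ι] using hy

theorem map_ι_y₂_mul_map_ι_y₁ [SetLike.GradedMonoid 𝒜]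
    (h : IsTrimmedRightDoubleOreExtension A p q y₁ y₂ σ)
    (hφ : quadraticRelations (doubleOreGrading A 𝒜 y₁ y₂) ≤ LinearMap.ker φ.toLinearMap) :
    φ (TensorAlgebra.ι k ⟨y₂, y₂_mem_doubleOreGrading⟩) *
        φ (TensorAlgebra.ι k ⟨y₁, y₁_mem_doubleOreGrading⟩) =
      p • (φ (TensorAlgebra.ι k ⟨y₁, y₁_mem_doubleOreGrading⟩) *
          φ (TensorAlgebra.ι k ⟨y₂, y₂_mem_doubleOreGrading⟩)) +
        q • φ (TensorAlgebra.ι k ⟨y₁, y₁_mem_doubleOreGrading⟩) ^ 2 := by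
  simp only [pow_two, ← map_mul, ← map_smul, ← map_add]
  refine map_eq_map_of_tensorToAlgebra_eq hφ (ι_mul_ι_mem_range_ι_pow_two _ _)
    (add_mem (Submodule.smul_mem _ _ (ι_mul_ι_mem_range_ι_pow_two _ _))
      (Submodule.smul_mem _ _ (ι_mul_ι_mem_range_ι_pow_two _ _))) ?_
  simpa only [map_add, map_smul, map_mul, tensorToAlgebra_ι, pow_two] using h.y₂_mul_y₁

theorem exists_algHom_comp_tensorToAlgebra_eq [SetLike.GradedMonoid 𝒜] (hA : IsQuadraticAlgebra 𝒜)
    (h : IsTrimmedRightDoubleOreExtension A p q y₁ y₂ σ)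
    (hσ : ∀ n, ∀ a ∈ 𝒜 n, ∀ i j, σ a i j ∈ 𝒜 n)
    (hφ : quadraticRelations (doubleOreGrading A 𝒜 y₁ y₂) ≤ LinearMap.ker φ.toLinearMap) :
    ∃ f : B →ₐ[k] Q, f.comp (tensorToAlgebra (doubleOreGrading A 𝒜 y₁ y₂)) = φ := by
  obtain ⟨α, hα⟩ := hA.exists_algHom (φ := φ.comp (tensorInclusion A 𝒜 y₁ y₂))
    fun t ht => hφ (quadraticRelations_le_comap_tensorInclusion ht)
  have hα₁ (a : 𝒜 1) : α a = φ (tensorInclusion A 𝒜 y₁ y₂ (TensorAlgebra.ι k a)) := by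
    rw [← AlgHom.comp_apply, ← hα, AlgHom.comp_apply, tensorToAlgebra_ι]
  obtain ⟨f, hfα, hf₁, hf₂⟩ := h.exists_algHom (α := α)
    (h.map_ι_y₂_mul_map_ι_y₁ hφ) (surjective_tensorToAlgebra_iff.1 hA.generated)
    (fun a ha => by
      simpa only [← hα₁] using map_ι_mul_map_tensorInclusion_ι hφ ⟨y₁, y₁_mem_doubleOreGrading⟩
        ⟨a, ha⟩ ⟨_, hσ 1 a ha 0 0⟩ ⟨_, hσ 1 a ha 0 1⟩ (by simpa using h.y₁_mul a))
    (fun a ha => by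
      simpa only [← hα₁] using map_ι_mul_map_tensorInclusion_ι hφ ⟨y₂, y₂_mem_doubleOreGrading⟩
        ⟨a, ha⟩ ⟨_, hσ 1 a ha 1 0⟩ ⟨_, hσ 1 a ha 1 1⟩ (by simpa using h.y₂_mul a))
  refine ⟨f, algHom_tensorAlgebra_ext hA.degree_zero (AlgHom.ext fun t => ?_) ?_ ?_⟩
  · simpa only [AlgHom.comp_apply, tensorToAlgebra_tensorInclusion, hfα] using
      DFunLike.congr_fun hα t
  · rw [AlgHom.comp_apply, tensorToAlgebra_ι, hf₁]
  · rw [AlgHom.comp_apply, tensorToAlgebra_ι, hf₂]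

end UniversalProperty

theorem isQuadraticAlgebra (hA : IsQuadraticAlgebra 𝒜)
    (h : IsTrimmedRightDoubleOreExtension A p q y₁ y₂ σ)
    (hσ : ∀ n, ∀ a ∈ 𝒜 n, ∀ i j, σ a i j ∈ 𝒜 n) :
    IsQuadraticAlgebra (doubleOreGrading A 𝒜 y₁ y₂) := by
  obtain ⟨_⟩ := hA.graded
  have := hA.nontrivial
  have := hA.finite_degree_one
  exact {
    graded := h.isGradedAlgebra_doubleOreGrading hσ
    nontrivial := Subtype.val_injective.nontrivial (α := A)
    degree_zero := doubleOreGrading_zero hA.degree_zero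
    finite_degree_one := finiteDimensional_doubleOreGrading_one hA.degree_zero
    generated := surjective_tensorToAlgebra_iff.2
      (h.adjoin_doubleOreGrading_one (surjective_tensorToAlgebra_iff.1 hA.generated))
    relations := ⟨quadraticRelations _, inf_le_left, fun _ =>
      tensorToAlgebra_eq_zero_iff_of_exists_algHom fun _ =>
        h.exists_algHom_comp_tensorToAlgebra_eq hA hσ⟩ }

end IsTrimmedRightDoubleOreExtension

theorem proposition2 {k B : Type*} [Field k] [Ring B] [Algebra k B]
    (A : Subalgebra k B) (𝒜 : ℕ → Submodule k A) (hA : IsKoszulAlgebra 𝒜)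
    (p q : k) (y₁ y₂ : B) (σ : A → Matrix (Fin 2) (Fin 2) A)
    (hB : IsTrimmedRightDoubleOreExtension A p q y₁ y₂ σ)
    (hσ : ∀ n, ∀ a ∈ 𝒜 n, ∀ i j, σ a i j ∈ 𝒜 n) :
    IsKoszulAlgebra (doubleOreGrading A 𝒜 y₁ y₂) := by
  obtain ⟨hquadratic, ⟨R⟩⟩ := hA
  obtain ⟨_⟩ := hquadratic.graded
  obtain ⟨_⟩ := hB.isGradedAlgebra_doubleOreGrading hσ
  have hlinear : GradedMod.IsLinear 0 (GradedMod.trivial (doubleOreGrading A 𝒜 y₁ y₂)) :=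
    hB.isLinear_trivial (R.isLinear_trivial hquadratic.degree_zero)
  exact ⟨hB.isQuadraticAlgebra hquadratic hσ, hlinear.nonempty_linearProjectiveResolution⟩
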